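/- Let $k$ be a field of characteristic zero, $A$ a commutative $k$-algebra and $(L,A)$ a Lie–Rinehart algebra over $k$ (so $L$ is an $A$-module and a $k$-Lie algebra that acts on $A$ by $k$-linear derivations $a\mapsto X(a)$, compatibly with brackets, with $(aX)(b)=a\,X(b)$ and $[X,aY]=X(a)Y+a[X,Y]$). For an $A$-module $M$ let $\mathrm{Alt}_A^m(L,M)$ be the module of alternating $A$-multilinear maps $L^m\to M$ and $\mathrm{Alt}_A(L,M)=\bigoplus_m \mathrm{Alt}_A^m(L,M)$. The naive de Rham differential $d_{\mathrm{dR}}:\mathrm{Alt}^m_A(L,A)\to \mathrm{Alt}^{m+1}_A(L,A)$ is given by the Koszul formula $$(d_{\mathrm{dR}}\omega)(X_0,\dots,X_m)=\sum_{l}(-1)^lX_l\big(\omega(X_0,\dots,\widehat{X_l},\dots,X_m)\big)+\sum_{i<j}(-1)^{i+j}\omega([X_i,X_j],X_0,\dots,\widehat{X_i},\dots,\widehat{X_j},\dots,X_m),$$ and $\mathrm H_{\mathrm{dR}}(L,A)$ denotes its cohomology (closed forms modulo exact forms). Forms with values in an associative $A$-algebra are multiplied by the cup product $$(\omega\cup\omega')(X_1,\dots,X_{p+q})=\sum_{\sigma\in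 \mathrm{Sh}_{p,q}}\operatorname{sgn}(\sigma)\,\omega(X_{\sigma(1)},\dots,X_{\sigma(p)})\,\omega'(X_{\sigma(p+1)},\dots,X_{\sigma(p+q)}).$$ Let $V$ be a finitely generated projective $A$-module. An $L$-connection $\nabla$ on $V$ is an $A$-linear assignment $X\mapsto\nabla_X\in\mathrm{End}_k(V)$ with $\nabla_X(av)=X(a)v+a\nabla_Xv$. Its curvature is the form $\mathcal R\in \mathrm{Alt}_A^2(L,\mathrm{End}_A(V))$, $\mathcal R(X,Y)=[\nabla_X,\nabla_Y]-\nabla_{[X,Y]}$. For $f=\sum_n c_nx^n\in k[x]$ put $f(\mathcal R)=\sum_n c_n\mathcal R^{\cup n}\in \mathrm{Alt}_A(L,\mathrm{End}_A(V))$, where $\mathcal R^{\cup 0}=\mathrm{id}_V$. The trace $\operatorname{trace}_V:\mathrm{End}_A(V)\to A$ is the contraction $V^*\otimes_AV\to A$ transported along $V^*\otimes_AV\cong\mathrm{End}_A(V)$, and it is applied to forms valuewise. Let $f\in k[x]$. (1) For every $L$-connection $\nabla$ on $V$ with curvature $\mathcal R$, the form $\operatorname{trace}_V(f(\mathcal R))\in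 \mathrm{Alt}_A(L,A)$ is $d_{\mathrm{dR}}$-closed. (2) Let $\nabla$ be an $L$-connection on $V$ and $\eta\in\mathrm{Hom}_A(L,\mathrm{End}_A(V))$. Let $\mathcal R$, $\mathcal R^\eta$ and $\mathcal R^s$ ($s\in k$) be the curvatures of the $L$-connections $\nabla$, $\nabla+\eta$ and $\nabla+s\eta$. Then $\operatorname{trace}_V(\eta\cup f'(\mathcal R^s))$ is a polynomial in $s$ with coefficients in $\mathrm{Alt}_A(L,A)$, and $$\operatorname{trace}_V(f(\mathcal R^\eta))-\operatorname{trace}_V(f(\mathcal R))=d_{\mathrm{dR}}\int_0^1\operatorname{trace}_V\big(\eta\cup f'(\mathcal R^s)\big)\,ds,$$ where the integral of a polynomial in $s$ is the formal one, $\int_0^1\sum_n\omega_ns^n\,ds=\sum_n\frac{\omega_n}{n+1}$. (3) The class $[\operatorname{trace}_V(f(\mathcal R))]\in \mathrm H_{\mathrm{dR}}(L,A)$ is the same for all $L$-connections $\nabla$ on $V$. -/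

import Mathlib

open scoped DirectSum Polynomial TensorProduct

noncomputable section

namespace ChernWeil

/-! ### Traces on finitely generated projective modules -/

section Trace

variable (A V : Type*) [CommRing A] [AddCommGroup V] [Module A V]

/-- The trace of an endomorphism of a finitely generated projective module: the contraction
`V* ⊗ V → A` transported along the canonical isomorphism `V* ⊗ V ≃ End V`. (`LinearMap.trace`
is only meaningful for free modules.) -/
def projTrace [Module.Finite A V] [Module.Projective A V] : Module.End A V →ₗ[A] A :=
  contractLeft A V ∘ₗ (dualTensorHomEquiv A V V).symm.toLinearMap

variable {A V}

/-- The trace can be computed in any coordinate system: if `∑ i, vᵢ* (v) • vᵢ = v` for all `v`,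
then `trace φ = ∑ i, vᵢ* (φ vᵢ)`. -/
theorem projTrace_eq_sum [Module.Finite A V] [Module.Projective A V] {ι : Type*} [Fintype ι]
    (b : ι → V) (c : ι → Module.Dual A V) (h : ∀ v, ∑ i, c i v • b i = v)
    (φ : Module.End A V) : projTrace A V φ = ∑ i, c i (φ (b i)) := by
  have hφ : φ = dualTensorHomEquiv A V V (∑ i, c i ⊗ₜ[A] φ (b i)) := by
    ext v
    conv_lhs => rw [← h v]
    simp [map_sum, dualTensorHom_apply]
  conv_lhs => rw [hφ]
  rw [projTrace, LinearMap.comp_apply, LinearEquiv.coe_coe, LinearEquiv.symm_apply_apply, map_sum]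
  simp

end Trace

/-! ### Formal integration of polynomial families over `[0, 1]` -/

section Integral

variable {k M : Type*} [Field k] [AddCommGroup M] [Module k M]

/-- `∫₀¹ ∑ₙ mₙ sⁿ ds = ∑ₙ mₙ / (n + 1)`, for a polynomial in `s` with coefficients in `M`. -/
def polyIntegral (p : PolynomialModule k M) : M :=
  p.coeff.sum fun n m => ((n : k) + 1)⁻¹ • m

/-- The family `ω : k → M` depends polynomially on its parameter. -/
def IsPolynomialFamily (ω : k → M) : Prop :=
  ∃ p : PolynomialModule k M, ∀ s, PolynomialModule.eval s p = ω s

open Classical in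
/-- `∫₀¹ ω(s) ds` for a family `ω` that depends polynomially on `s` (junk value `0` otherwise). -/
def integral01 (ω : k → M) : M :=
  if h : IsPolynomialFamily ω then polyIntegral h.choose else 0

theorem polynomialModule_eval_injective [Infinite k] {p q : PolynomialModule k M}
    (h : ∀ s, PolynomialModule.eval s p = PolynomialModule.eval s q) : p = q := by
  apply PolynomialModule.coeff_injective
  ext n
  rw [← sub_eq_zero, ← Module.forall_dual_apply_eq_zero_iff k]
  intro φ
  let P : PolynomialModule k M → k[X] := fun r =>
    r.coeff.sum fun n m => Polynomial.monomial n (φ m)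
  have hP : ∀ r s, (P r).eval s = φ (PolynomialModule.eval s r) := by
    intro r s
    simp only [P, PolynomialModule.eval_apply, Finsupp.sum, Polynomial.eval_finsetSum, map_sum,
      Polynomial.eval_monomial, map_smul, smul_eq_mul, mul_comm]
  have hc : ∀ r n, (P r).coeff n = φ (r.coeff n) := by
    intro r n
    simp only [P, Finsupp.sum, Polynomial.finsetSum_coeff, Polynomial.coeff_monomial]
    rw [Finset.sum_ite_eq' r.coeff.support n (fun i => φ (r.coeff i))]
    split_ifs with hn
    · rfl
    · rw [Finsupp.notMem_support_iff.mp hn, map_zero]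
  have : P p = P q := Polynomial.funext fun s => by rw [hP, hP, h]
  rw [map_sub, ← hc, ← hc, this, sub_self]

/-- The integral does not depend on the polynomial that represents the family. -/
theorem integral01_eq [Infinite k] {ω : k → M} (p : PolynomialModule k M)
    (h : ∀ s, PolynomialModule.eval s p = ω s) : integral01 ω = polyIntegral p := by
  have hω : IsPolynomialFamily ω := ⟨p, h⟩
  rw [integral01, dif_pos hω]
  congr 1
  exact polynomialModule_eval_injective fun s => (hω.choose_spec s).trans (h s).symm

end Integral

/-! ### Cohomology of a differential -/

section Cohomology

variable {R M : Type*} [Ring R] [AddCommGroup M] [Module R M]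

/-- The cohomology `ker d / im d` of an endomorphism `d` (with `d ∘ d = 0`) of a total complex. -/
abbrev EndCohomology (d : M →ₗ[R] M) : Type _ :=
  LinearMap.ker d ⧸ (LinearMap.range d).submoduleOf (LinearMap.ker d)

/-- The class of a closed element. -/
def EndCohomology.mk (d : M →ₗ[R] M) (x : M) (h : d x = 0) : EndCohomology d :=
  Submodule.Quotient.mk ⟨x, LinearMap.mem_ker.mpr h⟩

theorem EndCohomology.mk_eq_mk (d : M →ₗ[R] M) (x y : M) (hx : d x = 0) (hy : d y = 0) :
    mk d x hx = mk d y hy ↔ ∃ z, d z = x - y := by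
  rw [mk, mk, Submodule.Quotient.eq]
  rfl

end Cohomology

/-! ### Cup products and polynomials in forms -/

section Cup

/-- The total space `⨁ₘ Altₐᵐ(L, M)` of alternating `A`-multilinear forms on `L` with values
in `M`. -/
abbrev Forms (A L M : Type*) [CommRing A] [AddCommGroup L] [Module A L] [AddCommGroup M]
    [Module A M] : Type _ :=
  ⨁ m : ℕ, L [⋀^Fin m]→ₗ[A] M

variable {k A L E : Type*} [CommRing A] [AddCommGroup L] [Module A L] [Ring E] [Algebra A E]

/-- The cup product of two homogeneous forms with values in an `A`-algebra `E`:
`(ω ∪ ω')(X₁, …, X_{p+q}) = ∑_σ sgn(σ) ω(X_{σ(1)}, …, X_{σ(p)}) ω'(X_{σ(p+1)}, …, X_{σ(p+q)})`,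
the sum being over the `(p, q)`-shuffles. -/
def cupHom {p q : ℕ} (a : L [⋀^Fin p]→ₗ[A] E) (b : L [⋀^Fin q]→ₗ[A] E) :
    L [⋀^Fin (p + q)]→ₗ[A] E :=
  ((LinearMap.mul' A E).compAlternatingMap (a.domCoprod b)).domDomCongr finSumFinEquiv

/-- `cupHom` as a bilinear map. -/
def cupHomₗ (p q : ℕ) :
    (L [⋀^Fin p]→ₗ[A] E) →ₗ[A] (L [⋀^Fin q]→ₗ[A] E) →ₗ[A] (L [⋀^Fin (p + q)]→ₗ[A] E) :=
  LinearMap.mk₂ A cupHom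
    (fun a a' b => by
      simp only [cupHom, ← AlternatingMap.domCoprod'_apply, TensorProduct.add_tmul, map_add,
        LinearMap.compAlternatingMap_add, AlternatingMap.domDomCongr_add])
    (fun c a b => by
      simp only [cupHom, ← AlternatingMap.domCoprod'_apply, ← TensorProduct.smul_tmul', map_smul,
        LinearMap.compAlternatingMap_smul, AlternatingMap.domDomCongr_smul])
    (fun a b b' => by
      simp only [cupHom, ← AlternatingMap.domCoprod'_apply, TensorProduct.tmul_add, map_add,
        LinearMap.compAlternatingMap_add, AlternatingMap.domDomCongr_add])
    (fun c a b => by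
      simp only [cupHom, ← AlternatingMap.domCoprod'_apply, TensorProduct.tmul_smul, map_smul,
        LinearMap.compAlternatingMap_smul, AlternatingMap.domDomCongr_smul])

/-- The cup product on the total space of forms. -/
def cup : Forms A L E →ₗ[A] Forms A L E →ₗ[A] Forms A L E :=
  DirectSum.toModule A ℕ _ fun p => LinearMap.flip <| DirectSum.toModule A ℕ _ fun q =>
    LinearMap.flip <| (cupHomₗ p q).compr₂
      (DirectSum.lof A ℕ (fun m => L [⋀^Fin m]→ₗ[A] E) (p + q))

theorem cup_of {p q : ℕ} (a : L [⋀^Fin p]→ₗ[A] E) (b : L [⋀^Fin q]→ₗ[A] E) :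
    cup (DirectSum.of (fun m => L [⋀^Fin m]→ₗ[A] E) p a)
        (DirectSum.of (fun m => L [⋀^Fin m]→ₗ[A] E) q b) =
      DirectSum.of (fun m => L [⋀^Fin m]→ₗ[A] E) (p + q) (cupHom a b) := by
  simp only [cup, ← DirectSum.lof_eq_of A, DirectSum.toModule_lof, LinearMap.flip_apply,
    LinearMap.compr₂_apply]
  rfl

/-- The powers `ω ∪ ⋯ ∪ ω`, the zeroth one being the constant `0`-form `1`. -/
def cupPow (ω : Forms A L E) : ℕ → Forms A L E
  | 0 => DirectSum.of (fun m => L [⋀^Fin m]→ₗ[A] E) 0 (AlternatingMap.constOfIsEmpty A L (Fin 0) 1)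
  | n + 1 => cup (cupPow ω n) ω

/-- Substitution of a form `ω` into a polynomial `f = ∑ₙ cₙ xⁿ`: the form `∑ₙ cₙ ω^{∪n}`. -/
def polyForm [Field k] [Algebra k A] (f : k[X]) (ω : Forms A L E) : Forms A L E :=
  f.sum fun n c => algebraMap k A c • cupPow ω n

end Cup

/-- The trace `Altₐ(L, End V) → Altₐ(L, A)`, applied to the values of a form. -/
def traceForms {A L V : Type*} [CommRing A] [AddCommGroup L] [Module A L] [AddCommGroup V]
    [Module A V] [Module.Finite A V] [Module.Projective A V] :
    Forms A L (Module.End A V) →ₗ[A] Forms A L A :=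
  DirectSum.lmap fun _ => LinearMap.compAlternatingMapₗ A (projTrace A V)

/-! ### Connections on modules over Lie-Rinehart algebras -/

section Connection

variable (k A L V : Type*) [Field k] [CommRing A] [Algebra k A]
  [LieRing L] [LieAlgebra k L] [Module A L] [LieRingModule L A] [LieRinehartRing A L]
  [LieRinehartAlgebra k A L] [AddCommGroup V] [Module k V] [Module A V] [IsScalarTower k A V]

/-- An `L`-connection on the `A`-module `V`: an `A`-linear assignment `X ↦ ∇_X` of `k`-linear
endomorphisms of `V` such that `∇_X (a v) = X(a) v + a ∇_X v`. -/
@[ext]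
structure LConnection where
  toLinearMap : L →ₗ[A] (V →ₗ[k] V)
  leibniz : ∀ (X : L) (a : A) (v : V),
    toLinearMap X (a • v) = ⁅X, a⁆ • v + a • toLinearMap X v

variable {k A L V}

namespace LConnection

/-- The connection `∇ + η`, for an `End V`-valued one-form `η`. -/
def addForm (D : LConnection k A L V) (η : L →ₗ[A] Module.End A V) : LConnection k A L V where
  toLinearMap :=
    { toFun := fun X => D.toLinearMap X + (η X).restrictScalars k
      map_add' := fun X Y => by ext v; simp; abel
      map_smul' := fun a X => by ext v; simp }
  leibniz X a v := by
    simp [D.leibniz, add_assoc]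

variable (k A L) in
/-- The canonical `L`-connection `a ↦ X(a)` on `A`. -/
def canonical : LConnection k A L A where
  toLinearMap :=
    { toFun := fun X =>
        { toFun := fun a => ⁅X, a⁆
          map_add' := fun a b => lie_add X a b
          map_smul' := fun c a => lie_smul c X a }
      map_add' := fun X Y => by ext a; simp
      map_smul' := fun a X => by ext b; simp }
  leibniz X a b := by simp [add_comm]

/-- The curvature `R(X, Y) = [∇_X, ∇_Y] - ∇_[X, Y]`, as an endomorphism of the `A`-module `V`. -/
def curvatureEnd (D : LConnection k A L V) (X Y : L) : Module.End A V where
  toFun v := D.toLinearMap X (D.toLinearMap Y v) - D.toLinearMap Y (D.toLinearMap X v) -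
    D.toLinearMap ⁅X, Y⁆ v
  map_add' u v := by simp only [map_add]; abel
  map_smul' a v := by
    simp only [D.leibniz, map_add, lie_lie, RingHom.id_apply, smul_sub, sub_smul]
    abel

/-- The curvature as an `End V`-valued two-form. -/
def curvature (D : LConnection k A L V) : L [⋀^Fin 2]→ₗ[A] Module.End A V :=
  AlternatingMap.mk
    (MultilinearMap.mk' (fun X => D.curvatureEnd (X 0) (X 1))
      (fun X i x y => by
        ext v
        fin_cases i <;> simp [curvatureEnd] <;> abel)
      (fun X i c x => by
        ext v
        fin_cases i
        · have h : ⁅c • x, X 1⁆ = c • ⁅x, X 1⁆ - ⁅X 1, c⁆ • x := by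
            rw [← lie_skew, LieRinehartRing.leibniz_smul_right, ← lie_skew x (X 1), smul_neg]
            abel
          simp [curvatureEnd, h, D.leibniz, smul_sub]
          abel
        · simp [curvatureEnd, D.leibniz, smul_sub]
          abel))
    (fun X i j h hij => by
      have h01 : X 0 = X 1 := by
        fin_cases i <;> fin_cases j <;> simp_all
      ext v
      simp [curvatureEnd, h01])

end LConnection

/-! ### The covariant derivative and the naive de Rham complex -/

/-- Restriction of scalars for alternating maps. -/
def altRestrict {M : Type*} [AddCommGroup M] [Module k M] [Module A M] [IsScalarTower k A M] {m : ℕ}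
    (ω : L [⋀^Fin m]→ₗ[A] M) : L [⋀^Fin m]→ₗ[k] M :=
  { ω.toMultilinearMap.restrictScalars k with
    map_eq_zero_of_eq' := ω.map_eq_zero_of_eq' }

/-- The second sum of the Koszul formula,
`∑_{k < l} (-1)^{k+l} ω([X_k, X_l], X_0, …, X̂_k, …, X̂_l, …, X_m)`. The pairs `k < l` are written
as `k = i`, `l = j + 1` with `i ≤ j`. -/
def koszulBracket {M : Type*} [AddCommGroup M] [Module A M] :
    {m : ℕ} → (L [⋀^Fin m]→ₗ[A] M) → (Fin (m + 1) → L) → M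
  | 0, _, _ => 0
  | n + 1, ω, X => ∑ i : Fin (n + 1), ∑ j ≥ i, (-1 : ℤ) ^ ((i : ℕ) + ((j : ℕ) + 1)) •
      ω (Matrix.vecCons ⁅X i.castSucc, X j.succ⁆ (j.removeNth (i.castSucc.removeNth X)))

/-- The Koszul formula for the covariant derivative,
`∑_l (-1)^l ∇_{X_l} (ω(X_0, …, X̂_l, …, X_m))
  + ∑_{k < l} (-1)^{k+l} ω([X_k, X_l], X_0, …, X̂_k, …, X̂_l, …, X_m)`. -/
def koszul (D : LConnection k A L V) {m : ℕ} (ω : L [⋀^Fin m]→ₗ[A] V) (X : Fin (m + 1) → L) : V :=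
  (∑ l : Fin (m + 1), (-1 : ℤ) ^ (l : ℕ) • D.toLinearMap (X l) (ω (l.removeNth X))) +
    koszulBracket ω X

/-- The first sum of the Koszul formula. -/
def koszulAux₁ (D : LConnection k A L V) {m : ℕ} (ω : L [⋀^Fin m]→ₗ[A] V) :
    L [⋀^Fin (m + 1)]→ₗ[k] V :=
  AlternatingMap.alternatizeUncurryFin
    { toFun := fun X => (D.toLinearMap X).compAlternatingMap (altRestrict (k := k) ω)
      map_add' := fun X Y => by ext; simp
      map_smul' := fun c X => by
        ext v
        rw [← algebraMap_smul A c X]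
        simp [algebraMap_smul] }

theorem koszulAux₁_apply (D : LConnection k A L V) {m : ℕ} (ω : L [⋀^Fin m]→ₗ[A] V)
    (X : Fin (m + 1) → L) : koszulAux₁ D ω X =
      ∑ l : Fin (m + 1), (-1 : ℤ) ^ (l : ℕ) • D.toLinearMap (X l) (ω (l.removeNth X)) := by
  rw [koszulAux₁, AlternatingMap.alternatizeUncurryFin_apply]
  rfl

theorem exists_koszulBracket [CharZero k] {m : ℕ} (ω : L [⋀^Fin m]→ₗ[A] V) :
    ∃ G : L [⋀^Fin (m + 1)]→ₗ[k] V, ∀ X, G X = koszulBracket ω X := by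
  cases m with
  | zero => exact ⟨0, fun X => rfl⟩
  | succ n =>
    let F : L →ₗ[k] L →ₗ[k] L [⋀^Fin n]→ₗ[k] V :=
      LinearMap.mk₂ k (fun X Y => (altRestrict (k := k) ω).curryLeft ⁅X, Y⁆)
        (fun X X' Y => by simp) (fun c X Y => by simp)
        (fun X Y Y' => by simp) (fun c X Y => by simp)
    have hF : ∀ X Y v, F X Y v = ω (Matrix.vecCons ⁅X, Y⁆ v) := fun X Y v => rfl
    have hF' : ∀ X Y v, F Y X v = - F X Y v := fun X Y v => by
      have : F Y X = - F X Y := by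
        simp only [F, LinearMap.mk₂_apply]
        rw [← lie_skew X Y, map_neg, neg_neg]
      rw [this]; rfl
    refine ⟨-((2 : k)⁻¹ • AlternatingMap.alternatizeUncurryFin
      (AlternatingMap.alternatizeUncurryFinLM ∘ₗ F)), fun X => ?_⟩
    rw [AlternatingMap.neg_apply, AlternatingMap.smul_apply,
      AlternatingMap.alternatizeUncurryFin_alternatizeUncurryFinLM_comp_apply]
    simp only [koszulBracket, Finset.smul_sum, ← Finset.sum_neg_distrib]
    refine Finset.sum_congr rfl fun i _ => Finset.sum_congr rfl fun j _ => ?_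
    rw [hF' (X i.castSucc) (X j.succ), sub_neg_eq_add, ← two_smul k (F _ _ _), smul_comm,
      inv_smul_smul₀ two_ne_zero, hF, ← add_assoc, pow_succ, mul_neg_one, neg_smul]

theorem exists_koszul [CharZero k] (D : LConnection k A L V) {m : ℕ} (ω : L [⋀^Fin m]→ₗ[A] V) :
    ∃ G : L [⋀^Fin (m + 1)]→ₗ[k] V, ∀ X, G X = koszul D ω X := by
  obtain ⟨G, hG⟩ := exists_koszulBracket (k := k) ω
  exact ⟨koszulAux₁ D ω + G, fun X => by
    rw [AlternatingMap.add_apply, hG, koszulAux₁_apply, koszul]⟩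

theorem removeNth_succ_vecCons {L : Type*} {n : ℕ} (l : Fin (n + 1)) (x : L)
    (v : Fin (n + 1) → L) :
    l.succ.removeNth (Matrix.vecCons x v) = Matrix.vecCons x (l.removeNth v) := by
  ext p
  refine Fin.cases ?_ (fun q => ?_) p
  · simp [Fin.removeNth]
  · simp [Fin.removeNth, Fin.succ_succAbove_succ]

theorem removeNth_zero_vecCons {L : Type*} {n : ℕ} (x : L) (v : Fin n → L) :
    (0 : Fin (n + 1)).removeNth (Matrix.vecCons x v) = v := by
  ext p
  simp [Fin.removeNth]

theorem smul_lie_eq (a : A) (x y : L) : ⁅a • x, y⁆ = a • ⁅x, y⁆ + (-⁅y, a⁆) • x := by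
  rw [← lie_skew, LieRinehartRing.leibniz_smul_right, ← lie_skew x y, smul_neg, neg_smul]
  abel

/-- Failure of linearity of the first sum of the Koszul formula in the first argument. -/
theorem koszul_sum_smul (D : LConnection k A L V) {n : ℕ} (ω : L [⋀^Fin (n + 1)]→ₗ[A] V)
    (a : A) (x : L) (v : Fin (n + 1) → L) :
    (∑ l : Fin (n + 2), (-1 : ℤ) ^ (l : ℕ) • D.toLinearMap (Matrix.vecCons (a • x) v l)
        (ω (l.removeNth (Matrix.vecCons (a • x) v)))) =
      a • (∑ l : Fin (n + 2), (-1 : ℤ) ^ (l : ℕ) • D.toLinearMap (Matrix.vecCons x v l)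
        (ω (l.removeNth (Matrix.vecCons x v)))) +
      ∑ j : Fin (n + 1), (-1 : ℤ) ^ ((j : ℕ) + 1) • ⁅v j, a⁆ •
        ω (Matrix.vecCons x (j.removeNth v)) := by
  rw [Fin.sum_univ_succ, Fin.sum_univ_succ (n := n + 1), smul_add, add_assoc (G := V),
    Finset.smul_sum (s := Finset.univ), ← Finset.sum_add_distrib]
  congr 1
  · simp only [removeNth_zero_vecCons, Matrix.cons_val_zero]
    simp
  · refine Finset.sum_congr rfl fun j _ => ?_
    rw [removeNth_succ_vecCons, removeNth_succ_vecCons, Matrix.cons_val_succ,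
      Matrix.cons_val_succ, AlternatingMap.map_vecCons_smul, D.leibniz, Fin.val_succ, smul_add,
      smul_comm a, add_comm]

/-- Failure of linearity of the second sum of the Koszul formula in the first argument. -/
theorem koszulBracket_smul {n : ℕ} (ω : L [⋀^Fin (n + 1)]→ₗ[A] V)
    (a : A) (x : L) (v : Fin (n + 1) → L) :
    koszulBracket ω (Matrix.vecCons (a • x) v) = a • koszulBracket ω (Matrix.vecCons x v) -
      ∑ j : Fin (n + 1), (-1 : ℤ) ^ ((j : ℕ) + 1) • ⁅v j, a⁆ •
        ω (Matrix.vecCons x (j.removeNth v)) := by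
  simp only [koszulBracket]
  rw [Fin.sum_univ_succ, Fin.sum_univ_succ, smul_add, add_sub_right_comm]
  congr 1
  · have h0 : Finset.Ici (0 : Fin (n + 1)) = Finset.univ := by ext; simp
    rw [h0, Finset.smul_sum, ← Finset.sum_sub_distrib]
    refine Finset.sum_congr rfl fun j _ => ?_
    rw [Fin.castSucc_zero, removeNth_zero_vecCons, removeNth_zero_vecCons, Matrix.cons_val_succ,
      Matrix.cons_val_succ, Matrix.cons_val_zero, Matrix.cons_val_zero, smul_lie_eq,
      AlternatingMap.map_vecCons_add, AlternatingMap.map_vecCons_smul,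
      AlternatingMap.map_vecCons_smul, smul_add, neg_smul, smul_neg, Fin.val_zero, zero_add,
      smul_comm a, sub_eq_add_neg]
  · rw [Finset.smul_sum]
    refine Finset.sum_congr rfl fun i _ => ?_
    rw [Finset.smul_sum]
    refine Finset.sum_congr rfl fun j hj => ?_
    cases n with
    | zero => exact i.elim0
    | succ n =>
      have hj0 : j ≠ 0 := fun h => by
        subst h
        simp at hj
      obtain ⟨j, rfl⟩ := Fin.exists_succ_eq.mpr hj0
      rw [← Fin.succ_castSucc, removeNth_succ_vecCons, removeNth_succ_vecCons,
        removeNth_succ_vecCons, removeNth_succ_vecCons, Matrix.cons_val_succ,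
        Matrix.cons_val_succ, Matrix.cons_val_succ, Matrix.cons_val_succ, smul_comm a]
      congr 1
      exact (ω.curryLeft ⁅v i.castSucc, v j.succ⁆).map_vecCons_smul _ a x

theorem koszul_smul_head (D : LConnection k A L V) {m : ℕ} (ω : L [⋀^Fin m]→ₗ[A] V)
    (a : A) (x : L) (v : Fin m → L) :
    koszul D ω (Matrix.vecCons (a • x) v) = a • koszul D ω (Matrix.vecCons x v) := by
  cases m with
  | zero =>
    simp only [koszul, koszulBracket, add_zero]
    rw [Fin.sum_univ_one, Fin.sum_univ_one]
    simp only [removeNth_zero_vecCons, Matrix.cons_val_zero]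
    simp
  | succ n =>
    rw [koszul, koszul, koszul_sum_smul, koszulBracket_smul, smul_add]
    abel

theorem koszul_update_smul [CharZero k] (D : LConnection k A L V) {m : ℕ}
    (ω : L [⋀^Fin m]→ₗ[A] V) (X : Fin (m + 1) → L) (i : Fin (m + 1)) (a : A) (x : L) :
    koszul D ω (Function.update X i (a • x)) = a • koszul D ω (Function.update X i x) := by
  obtain ⟨G, hG⟩ := exists_koszul D ω
  have key : ∀ y, koszul D ω (Function.update X i y) =
      (-1 : ℤ) ^ (i : ℕ) • koszul D ω (Matrix.vecCons y (i.removeNth X)) := fun y => by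
    rw [← hG, ← hG, ← AlternatingMap.map_insertNth, Fin.insertNth_removeNth]
  rw [key, key, koszul_smul_head, smul_comm]

/-- The covariant derivative `∇ : Altₐᵐ(L, V) → Altₐᵐ⁺¹(L, V)`, given by the Koszul formula. -/
def covDeriv [CharZero k] (D : LConnection k A L V) (m : ℕ) :
    (L [⋀^Fin m]→ₗ[A] V) →ₗ[k] (L [⋀^Fin (m + 1)]→ₗ[A] V) where
  toFun ω :=
    { toFun := koszul D ω
      map_update_add' := fun {inst} X i x y => by
        obtain ⟨G, hG⟩ := exists_koszul D ω
        simp only [← hG]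
        exact G.toMultilinearMap.map_update_add' X i x y
      map_update_smul' := fun {inst} X i a x => by
        rw [Subsingleton.elim inst (fun a b => instDecidableEqFin (m + 1) a b)]
        exact koszul_update_smul D ω X i a x
      map_eq_zero_of_eq' := fun X i j h hij => by
        obtain ⟨G, hG⟩ := exists_koszul D ω
        rw [← hG]
        exact G.map_eq_zero_of_eq X h hij }
  map_add' ω ω' := by
    ext X
    change koszul D (ω + ω') X = koszul D ω X + koszul D ω' X
    cases m
    · simp [koszul, koszulBracket]
    · simp only [koszul, koszulBracket, AlternatingMap.add_apply, map_add, smul_add,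
        Finset.sum_add_distrib]
      abel
  map_smul' c ω := by
    ext X
    change koszul D (c • ω) X = c • koszul D ω X
    cases m <;> simp [koszul, koszulBracket, Finset.smul_sum, smul_comm c]

variable (k A L) in
/-- The naive de Rham differential in degree `m`: the Koszul formula for the action of `L`
on `A`. -/
def dDRHom [CharZero k] (m : ℕ) : (L [⋀^Fin m]→ₗ[A] A) →ₗ[k] (L [⋀^Fin (m + 1)]→ₗ[A] A) :=
  covDeriv (LConnection.canonical k A L) m

/-- The Koszul formula for the de Rham differential. -/
theorem dDRHom_apply [CharZero k] {m : ℕ} (ω : L [⋀^Fin m]→ₗ[A] A) (X : Fin (m + 1) → L) :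
    dDRHom k A L m ω X =
      (∑ l : Fin (m + 1), (-1 : ℤ) ^ (l : ℕ) • ⁅X l, ω (l.removeNth X)⁆) + koszulBracket ω X :=
  rfl

variable (k A L) in
/-- The naive de Rham differential on the total space of forms. -/
def dDR [CharZero k] : Forms A L A →ₗ[k] Forms A L A :=
  DirectSum.toModule k ℕ _ fun m =>
    DirectSum.lof k ℕ (fun m => L [⋀^Fin m]→ₗ[A] A) (m + 1) ∘ₗ dDRHom k A L m

variable (k A L) in
/-- The naive de Rham cohomology `H_dR(L, A)`: closed forms modulo exact forms. -/
abbrev HdR [CharZero k] : Type _ := EndCohomology (dDR k A L)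

/-- The cohomology class of a closed form. -/
def HdR.mk [CharZero k] (ω : Forms A L A) (h : dDR k A L ω = 0) : HdR k A L :=
  EndCohomology.mk (dDR k A L) ω h

/-- `f(R)`, for the curvature `R` of a connection and a polynomial `f`. -/
def LConnection.polyCurvature (D : LConnection k A L V) (f : k[X]) :
    Forms A L (Module.End A V) :=
  polyForm f (DirectSum.of (fun m => L [⋀^Fin m]→ₗ[A] Module.End A V) 2 D.curvature)

variable (A) in
/-- An `End V`-valued one-form `η`, as an element of the total space of forms. -/
def oneForm (η : L →ₗ[A] Module.End A V) : Forms A L (Module.End A V) :=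
  DirectSum.of (fun m => L [⋀^Fin m]→ₗ[A] Module.End A V) 1
    (AlternatingMap.ofSubsingleton A L (Module.End A V) (0 : Fin 1) η)

end Connection

end ChernWeil

end

open ChernWeil

/-!
The space of forms with the cup product is treated as a graded algebra, and every identity between
forms is proved by contraction. A form is determined by its component of degree `0` and its
contractions `ι_x`, and `ι_x` is an antiderivation of the cup product (`contr_cup`). Hence a
biadditive expression in two forms vanishes as soon as it does in degree `0` and its contractions
reduce to the same expression in lower degree (`forms_induction₂`). This yields associativity
(`cup_assoc`) and the graded commutativity of the trace (`two_smul_traceForms_cup`). For the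
covariant derivative `d`, the Lie derivative `L_x = ι_x d + d ι_x` is computed from the Koszul
formula (`lieD_apply`); it satisfies `[L_x, ι_y] = ι_[x, y]`, so that `L_x` is a derivation
(`lieD_cup`) and `d` an antiderivation (`covD_cup`) of the cup product.

A connection on `V` induces the connection `[∇_X, -]` on `End V`, for which the trace is parallel
(`projTrace_endConn`), so `d_dR (trace ω) = trace (∇ω)` (`dDR_traceForms`). With the Bianchi
identity `∇R = 0` (`covD_curvForm`) the form `trace (f(R))` is closed. For the transgression
formula, `R^s = R + s ∇η + s² η ∪ η` has the derivative `∇^s η` with respect to `s`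
(`curvForm_mem_polyDerivPairs`). Since the trace is symmetric on even forms, the derivative of
`trace (f(R^s))` is `trace (∇^s η ∪ f'(R^s))`, which is `d_dR trace (η ∪ f'(R^s))` by the Leibniz
rule and the Bianchi identity. The fundamental theorem of calculus for polynomial families
(`integral01_of_mem`) turns this into the formula. As any two connections differ by a one-form, the
cohomology class does not depend on the connection.
-/

noncomputable section

namespace ChernWeil

/-! ### Contraction and parity on the space of forms -/

section Calculus

variable {A L M M' N : Type*} [CommRing A] [AddCommGroup L] [Module A L]
  [AddCommGroup M] [Module A M] [AddCommGroup M'] [Module A M'] [AddCommGroup N] [Module A N]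

/-- The contraction `ι_x` of forms with `x`, inserted in the first argument; it vanishes on
`0`-forms. -/
def contr (x : L) : Forms A L M →ₗ[A] Forms A L M :=
  DirectSum.toModule A ℕ _ fun m => match m with
    | 0 => 0
    | n + 1 => DirectSum.lof A ℕ (fun m => L [⋀^Fin m]→ₗ[A] M) n ∘ₗ
        AlternatingMap.curryLeftLinearMap.flip x

theorem contr_of_zero (x : L) (ω : L [⋀^Fin 0]→ₗ[A] M) :
    contr x (DirectSum.of (fun m => L [⋀^Fin m]→ₗ[A] M) 0 ω) = 0 := by
  rw [← DirectSum.lof_eq_of A, contr, DirectSum.toModule_lof]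
  rfl

theorem contr_of_succ (x : L) {n : ℕ} (ω : L [⋀^Fin (n + 1)]→ₗ[A] M) :
    contr x (DirectSum.of (fun m => L [⋀^Fin m]→ₗ[A] M) (n + 1) ω) =
      DirectSum.of (fun m => L [⋀^Fin m]→ₗ[A] M) n (ω.curryLeft x) := by
  rw [← DirectSum.lof_eq_of A, contr, DirectSum.toModule_lof]
  rfl

/-- The grading involution `ω ↦ (-1)^m ω` for `m`-forms `ω`. -/
def parity : Forms A L M →ₗ[A] Forms A L M :=
  DirectSum.lmap fun m => (-1 : ℤ) ^ m • LinearMap.id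

theorem parity_of {m : ℕ} (ω : L [⋀^Fin m]→ₗ[A] M) :
    parity (DirectSum.of (fun m => L [⋀^Fin m]→ₗ[A] M) m ω) =
      (-1 : ℤ) ^ m • DirectSum.of (fun m => L [⋀^Fin m]→ₗ[A] M) m ω := by
  rw [← DirectSum.lof_eq_of A, parity, DirectSum.lmap_lof, LinearMap.smul_apply,
    LinearMap.id_apply, map_zsmul]

theorem forms_hom_ext {G : Type*} [AddCommMonoid G] {f g : Forms A L M →+ G}
    (h : ∀ m (ω : L [⋀^Fin m]→ₗ[A] M), f (DirectSum.of (fun m => L [⋀^Fin m]→ₗ[A] M) m ω) =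
      g (DirectSum.of (fun m => L [⋀^Fin m]→ₗ[A] M) m ω)) (ω : Forms A L M) : f ω = g ω :=
  DFunLike.congr_fun (DirectSum.addHom_ext h) ω

theorem contr_apply (x : L) (ω : Forms A L M) (n : ℕ) (v : Fin n → L) :
    contr x ω n v = ω (n + 1) (Matrix.vecCons x v) := by
  induction ω using DirectSum.induction_on with
  | zero => simp
  | add ω ω' h h' => simp [h, h']
  | of m ω =>
    cases m with
    | zero => rw [contr_of_zero, DirectSum.of_eq_of_ne _ _ _ (Nat.succ_ne_zero n)]; rfl
    | succ m =>
      rw [contr_of_succ]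
      by_cases h : n = m
      · subst h
        rw [DirectSum.of_eq_same, DirectSum.of_eq_same]
        rfl
      · rw [DirectSum.of_eq_of_ne _ _ _ h, DirectSum.of_eq_of_ne _ _ _ (by simpa using h)]
        rfl

theorem parity_apply (ω : Forms A L M) (n : ℕ) : parity ω n = (-1 : ℤ) ^ n • ω n := by
  rw [parity, DirectSum.lmap_apply, LinearMap.smul_apply, LinearMap.id_apply]

theorem forms_ext {ω ω' : Forms A L M} (h : ∀ n v, ω n v = ω' n v) : ω = ω' := by
  refine DFinsupp.ext fun n => ?_
  ext v
  exact h n v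

theorem forms_ext_of_degree {m : ℕ} {ω ω' : Forms A L M} (hω : ∀ n ≠ m, ω n = 0)
    (hω' : ∀ n ≠ m, ω' n = 0) (h : ∀ v, ω m v = ω' m v) : ω = ω' := by
  refine forms_ext fun n v => ?_
  by_cases hn : n = m
  · subst hn; exact h v
  · rw [hω n hn, hω' n hn]

/-- A form is determined by its contractions and its component of degree `0`. -/
theorem eq_zero_of_contr {ω : Forms A L M} (h0 : ω 0 = 0) (h : ∀ x, contr x ω = 0) : ω = 0 := by
  refine forms_ext fun n v => ?_
  cases n with
  | zero => rw [h0]; rfl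
  | succ n =>
    have := contr_apply (v 0) ω n (Matrix.vecTail v)
    rw [h] at this
    rw [← Matrix.cons_head_tail v]
    exact this.symm

theorem forms_neg_apply (ω : Forms A L M) (n : ℕ) : (-ω) n = -ω n :=
  DFinsupp.neg_apply ω n

theorem forms_sub_apply (ω ω' : Forms A L M) (n : ℕ) : (ω - ω') n = ω n - ω' n :=
  DFinsupp.sub_apply ω ω' n

theorem forms_zsmul_apply (c : ℤ) (ω : Forms A L M) (n : ℕ) : (c • ω) n = c • ω n :=
  DFinsupp.smul_apply c ω n

theorem parity_parity (ω : Forms A L M) : parity (parity ω) = ω := by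
  refine forms_ext fun n v => ?_
  rw [parity_apply, parity_apply, smul_smul, ← mul_pow]
  simp

theorem contr_parity (x : L) (ω : Forms A L M) : contr x (parity ω) = -parity (contr x ω) := by
  refine forms_ext fun n v => ?_
  rw [contr_apply, parity_apply, forms_neg_apply, AlternatingMap.neg_apply, parity_apply,
    AlternatingMap.smul_apply, AlternatingMap.smul_apply, contr_apply, pow_succ]
  simp

/-- A map on forms that is compatible with contractions and has no component of degree `0`
vanishes. -/
theorem forms_induction (G : Forms A L M → Forms A L N) (hadd : ∀ a a', G (a + a') = G a + G a')
    (h0 : ∀ a, G a 0 = 0) (h : ∀ x a, G (contr x a) = 0 → contr x (G a) = 0) (a : Forms A L M) :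
    G a = 0 := by
  have map_zero : G 0 = 0 := map_zero (AddMonoidHom.mk' G hadd)
  refine forms_hom_ext (f := AddMonoidHom.mk' G hadd) (g := 0) (fun m ω => ?_) a
  change G _ = 0
  induction m with
  | zero =>
    refine eq_zero_of_contr (h0 _) fun x => h x _ ?_
    rw [contr_of_zero, map_zero]
  | succ m ih =>
    refine eq_zero_of_contr (h0 _) fun x => h x _ ?_
    rw [contr_of_succ]
    exact ih _

/-- The induction principle on the total degree behind all identities for cup products: a
biadditive expression in two forms vanishes if its component of degree `0` does, and if its
contractions vanish as soon as the expression vanishes after contracting one of the two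
arguments. -/
theorem forms_induction₂ (F : Forms A L M → Forms A L M' → Forms A L N)
    (hl : ∀ a a' b, F (a + a') b = F a b + F a' b) (hr : ∀ a b b', F a (b + b') = F a b + F a b')
    (h0 : ∀ a b, F a b 0 = 0)
    (h : ∀ x a b, F (contr x a) b = 0 → F (parity a) (contr x b) = 0 → contr x (F a b) = 0)
    (a : Forms A L M) (b : Forms A L M') : F a b = 0 := by
  suffices H : ∀ n p q, p + q = n → ∀ (a : L [⋀^Fin p]→ₗ[A] M) (b : L [⋀^Fin q]→ₗ[A] M'),
      F (DirectSum.of (fun m => L [⋀^Fin m]→ₗ[A] M) p a)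
        (DirectSum.of (fun m => L [⋀^Fin m]→ₗ[A] M') q b) = 0 by
    exact forms_hom_ext (f := AddMonoidHom.mk' (F · b) fun a a' => hl a a' b) (g := 0)
      (fun p a => forms_hom_ext (f := AddMonoidHom.mk' (F _) fun b b' => hr _ b b') (g := 0)
        (fun q b => H _ p q rfl a b) b) a
  have zero_left : ∀ b, F 0 b = 0 := fun b =>
    map_zero (AddMonoidHom.mk' (F · b) fun a a' => hl a a' b)
  have zero_right : ∀ a, F a 0 = 0 := fun a =>
    map_zero (AddMonoidHom.mk' (F a) fun b b' => hr a b b')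
  intro n
  induction n with
  | zero =>
    intro p q hpq a b
    obtain rfl : p = 0 := by omega
    obtain rfl : q = 0 := by omega
    refine eq_zero_of_contr (h0 _ _) fun x => h x _ _ ?_ ?_
    · rw [contr_of_zero, zero_left]
    · rw [contr_of_zero, zero_right]
  | succ n ih =>
    intro p q hpq a b
    refine eq_zero_of_contr (h0 _ _) fun x => h x _ _ ?_ ?_
    · cases p with
      | zero => rw [contr_of_zero, zero_left]
      | succ p => rw [contr_of_succ, ih p q (by omega)]
    · cases q with
      | zero => rw [contr_of_zero, zero_right]
      | succ q =>
        rw [contr_of_succ, parity_of]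
        refine (map_zsmul (AddMonoidHom.mk' (F · _) fun a a' => hl a a' _) _ _).trans ?_
        exact (congr_arg _ (ih p q (by omega) a _)).trans (smul_zero _)

variable {k : Type*} [Field k] [Algebra k A] [Module k M] [IsScalarTower k A M]

theorem forms_smul_apply (c : k) (ω : Forms A L M) (n : ℕ) : (c • ω) n = c • ω n :=
  DFinsupp.smul_apply c ω n

instance : IsScalarTower k A (Forms A L M) where
  smul_assoc c a ω := forms_ext fun n v => smul_assoc c a (ω n v)

end Calculus

/-! ### Contractions are antiderivations of the cup product -/

section CupContr

open Equiv

variable {A L E : Type*} [CommRing A] [AddCommGroup L] [Module A L] [Ring E] [Algebra A E]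

/-- The sum over all permutations that equals `p! q!` times the cup product of a `p`-form and a
`q`-form. The equation `p + q = n` is an argument in order to avoid casts between spaces of
forms. -/
def permSum {p q n : ℕ} (h : p + q = n) (a : L [⋀^Fin p]→ₗ[A] E) (b : L [⋀^Fin q]→ₗ[A] E)
    (v : Fin n → L) : E :=
  ∑ σ : Perm (Fin n), (Perm.sign σ : ℤ) •
    (a (fun i => v (σ (Fin.cast h (Fin.castAdd q i)))) *
      b (fun j => v (σ (Fin.cast h (Fin.natAdd p j)))))

theorem factorial_smul_cupHom {p q : ℕ} (a : L [⋀^Fin p]→ₗ[A] E) (b : L [⋀^Fin q]→ₗ[A] E)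
    (v : Fin (p + q) → L) : (p.factorial * q.factorial) • cupHom a b v = permSum rfl a b v := by
  have h := MultilinearMap.domCoprod_alternization_eq a b
  rw [Fintype.card_fin, Fintype.card_fin] at h
  have h' := congr_arg (LinearMap.mul' A E) (DFunLike.congr_fun h (v ∘ finSumFinEquiv))
  rw [MultilinearMap.alternatization_apply, map_sum, AlternatingMap.smul_apply, map_nsmul] at h'
  change _ = (p.factorial * q.factorial) • cupHom a b v at h'
  rw [← h', permSum]
  refine Fintype.sum_equiv (finSumFinEquiv.permCongr) _ _ fun σ => ?_
  rw [Perm.sign_permCongr, Units.smul_def, map_zsmul]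
  congr 1
  simp [MultilinearMap.domDomCongr_apply, Function.comp_def]

theorem factorial_smul_cup_apply {p q n : ℕ} (h : p + q = n) (a : L [⋀^Fin p]→ₗ[A] E)
    (b : L [⋀^Fin q]→ₗ[A] E) (v : Fin n → L) : (p.factorial * q.factorial) •
      cup (DirectSum.of (fun m => L [⋀^Fin m]→ₗ[A] E) p a)
        (DirectSum.of (fun m => L [⋀^Fin m]→ₗ[A] E) q b) n v = permSum h a b v := by
  subst h
  rw [cup_of, DirectSum.of_eq_same, factorial_smul_cupHom]

omit [AddCommGroup L] in
/-- Permutations `σ` of `n + 1` points, sorted by the position `i = σ⁻¹ 0` of the first argument and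
the induced permutation `e` of the other `n` arguments. -/
theorem sum_perm_fin_succ {G : Type*} [AddCommGroup G] {n : ℕ} (f : (Fin (n + 1) → L) → G) (x : L)
    (v : Fin n → L) :
    ∑ σ : Perm (Fin (n + 1)), (Perm.sign σ : ℤ) • f (Matrix.vecCons x v ∘ σ) =
      ∑ i : Fin (n + 1), ∑ e : Perm (Fin n),
        ((-1 : ℤ) ^ (i : ℕ) * Perm.sign e) • f (i.insertNth x (v ∘ e)) := by
  let φ : Fin (n + 1) × Perm (Fin n) → Perm (Fin (n + 1)) := fun ie =>
    Perm.decomposeFin.symm (0, ie.2) * ie.1.cycleRange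
  have hφ : Function.Bijective φ := by
    rw [Fintype.bijective_iff_injective_and_card]
    refine ⟨?_, (Fintype.card_congr Perm.decomposeFin).symm⟩
    rintro ⟨i, e⟩ ⟨j, e'⟩ h
    have hi : ∀ (i : Fin (n + 1)) e, (φ (i, e)).symm 0 = i := fun i e => by
      rw [Equiv.symm_apply_eq]
      simp [φ]
    obtain rfl : i = j := by rw [← hi i e, h, hi]
    have := Perm.decomposeFin.symm.injective (mul_right_cancel h)
    simpa using this
  rw [← Fintype.sum_prod_type', ← hφ.sum_comp]
  refine Finset.sum_congr rfl fun ie _ => ?_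
  have h1 : Perm.sign (φ ie) = Perm.sign ie.2 * (-1) ^ (ie.1 : ℕ) := by
    simp [φ, Fin.sign_cycleRange]
  have h2 : Matrix.vecCons x v ∘ φ ie = ie.1.insertNth x (v ∘ ie.2) := by
    rw [← Fin.cons_comp_cycleRange, Perm.coe_mul, ← Function.comp_assoc]
    congr 1
    ext j
    refine Fin.cases ?_ (fun j => ?_) j
    · simp
    · simp
  rw [h1, h2]
  push_cast
  rw [mul_comm]

omit [AddCommGroup L] in
/-- The vector `u` with `x` inserted at a position in the first block, restricted to that block. -/
theorem insertNth_left {p q n : ℕ} (h : p + 1 + q = n + 1) (h' : p + q = n) (s : Fin (p + 1))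
    (x : L) (u : Fin n → L) :
    (fun i => (Fin.cast h (Fin.castAdd q s)).insertNth (α := fun _ => L) x u
        (Fin.cast h (Fin.castAdd q i))) =
      s.insertNth x (fun i => u (Fin.cast h' (Fin.castAdd q i))) := by
  refine Fin.eq_insertNth_iff.mpr ⟨by simp, ?_⟩
  ext i
  have : Fin.cast h (Fin.castAdd q (s.succAbove i)) =
      (Fin.cast h (Fin.castAdd q s)).succAbove (Fin.cast h' (Fin.castAdd q i)) := by
    ext; simp only [Fin.succAbove, Fin.lt_def, apply_ite]; simp
  rw [Fin.removeNth, this, Fin.insertNth_apply_succAbove]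

omit [AddCommGroup L] in
/-- Insertion at a position in the second block does not affect the first block. -/
theorem insertNth_left_of_right {p q n : ℕ} (h : p + (q + 1) = n + 1) (h' : p + q = n)
    (t : Fin (q + 1)) (x : L) (u : Fin n → L) :
    (fun i => (Fin.cast h (Fin.natAdd p t)).insertNth (α := fun _ => L) x u
        (Fin.cast h (Fin.castAdd (q + 1) i))) = fun i => u (Fin.cast h' (Fin.castAdd q i)) := by
  ext i
  have : Fin.cast h (Fin.castAdd (q + 1) i) =
      (Fin.cast h (Fin.natAdd p t)).succAbove (Fin.cast h' (Fin.castAdd q i)) := by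
    ext; simp only [Fin.succAbove, Fin.lt_def, apply_ite]; simp; omega
  rw [this, Fin.insertNth_apply_succAbove]

omit [AddCommGroup L] in
theorem insertNth_right {p q n : ℕ} (h : p + (q + 1) = n + 1) (h' : p + q = n)
    (t : Fin (q + 1)) (x : L) (u : Fin n → L) :
    (fun j => (Fin.cast h (Fin.natAdd p t)).insertNth (α := fun _ => L) x u
        (Fin.cast h (Fin.natAdd p j))) =
      t.insertNth x (fun j => u (Fin.cast h' (Fin.natAdd p j))) := by
  refine Fin.eq_insertNth_iff.mpr ⟨by simp, ?_⟩
  ext i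
  have : Fin.cast h (Fin.natAdd p (t.succAbove i)) =
      (Fin.cast h (Fin.natAdd p t)).succAbove (Fin.cast h' (Fin.natAdd p i)) := by
    ext
    simp only [Fin.succAbove, Fin.lt_def, apply_ite]
    simp
    split_ifs <;> omega
  rw [Fin.removeNth, this, Fin.insertNth_apply_succAbove]

omit [AddCommGroup L] in
theorem insertNth_right_of_left {p q n : ℕ} (h : p + 1 + q = n + 1) (h' : p + q = n)
    (s : Fin (p + 1)) (x : L) (u : Fin n → L) :
    (fun j => (Fin.cast h (Fin.castAdd q s)).insertNth (α := fun _ => L) x u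
        (Fin.cast h (Fin.natAdd (p + 1) j))) = fun j => u (Fin.cast h' (Fin.natAdd p j)) := by
  ext i
  have : Fin.cast h (Fin.natAdd (p + 1) i) =
      (Fin.cast h (Fin.castAdd q s)).succAbove (Fin.cast h' (Fin.natAdd p i)) := by
    ext; simp only [Fin.succAbove, Fin.lt_def, apply_ite]; simp; omega
  rw [this, Fin.insertNth_apply_succAbove]

/-- The antiderivation property, up to factorials. Each of the `p` positions of `x` among the
arguments of `a` contributes the same sum, and so does each of the `q` positions among the arguments
of `b`. -/
theorem permSum_vecCons {p q n : ℕ} (h : p + q = n + 1) (a : L [⋀^Fin p]→ₗ[A] E)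
    (b : L [⋀^Fin q]→ₗ[A] E) (x : L) (v : Fin n → L) :
    permSum h a b (Matrix.vecCons x v) = (p.factorial * q.factorial) •
      (cup (contr x (DirectSum.of (fun m => L [⋀^Fin m]→ₗ[A] E) p a))
          (DirectSum.of (fun m => L [⋀^Fin m]→ₗ[A] E) q b) +
        cup (parity (DirectSum.of (fun m => L [⋀^Fin m]→ₗ[A] E) p a))
          (contr x (DirectSum.of (fun m => L [⋀^Fin m]→ₗ[A] E) q b))) n v := by
  let f : (Fin (n + 1) → L) → E := fun u =>
    a (fun i => u (Fin.cast h (Fin.castAdd q i))) * b (fun j => u (Fin.cast h (Fin.natAdd p j)))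
  have hsum : permSum h a b (Matrix.vecCons x v) = _ := sum_perm_fin_succ f x v
  rw [hsum, ← (finSumFinEquiv.trans (finCongr h)).sum_comp, Fintype.sum_sum_type,
    DirectSum.add_apply, AlternatingMap.add_apply, smul_add]
  congr 1
  · cases p with
    | zero =>
      rw [contr_of_zero, map_zero, LinearMap.zero_apply]
      simp
    | succ p =>
      have h' : p + q = n := by omega
      rw [contr_of_succ, Nat.factorial_succ, mul_assoc, mul_smul, factorial_smul_cup_apply h']
      refine (Finset.sum_congr rfl fun s _ => ?_).trans
        (Fin.sum_const (p + 1) (permSum h' (a.curryLeft x) b v))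
      refine Finset.sum_congr rfl fun e _ => ?_
      simp only [f, Equiv.trans_apply, finSumFinEquiv_apply_left, finCongr_apply,
        insertNth_left h h', insertNth_right_of_left h h', a.map_insertNth]
      rw [Fin.val_cast, Fin.val_castAdd, mul_comm, mul_smul, smul_mul_assoc, smul_smul _ _ (_ * _),
        ← mul_pow]
      simp
  · cases q with
    | zero =>
      rw [contr_of_zero, map_zero]
      simp
    | succ q =>
      have h' : p + q = n := by omega
      rw [contr_of_succ, Nat.factorial_succ, mul_left_comm, mul_smul, parity_of, map_zsmul,
        LinearMap.smul_apply, forms_zsmul_apply, AlternatingMap.smul_apply,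
        smul_comm _ ((-1 : ℤ) ^ p), factorial_smul_cup_apply h']
      refine (Finset.sum_congr rfl fun s _ => ?_).trans
        (Fin.sum_const (q + 1) ((-1 : ℤ) ^ p • permSum h' a (b.curryLeft x) v))
      rw [permSum, Finset.smul_sum]
      refine Finset.sum_congr rfl fun e _ => ?_
      simp only [f, Equiv.trans_apply, finSumFinEquiv_apply_right, finCongr_apply,
        insertNth_right h h', insertNth_left_of_right h h', b.map_insertNth]
      rw [Fin.val_cast, Fin.val_natAdd, pow_add, mul_smul_comm, smul_smul, mul_right_comm,
        mul_assoc ((-1) ^ p), ← mul_pow, smul_smul]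
      simp [AlternatingMap.curryLeft_apply_apply]

theorem contr_cup [IsAddTorsionFree E] (x : L) (a b : Forms A L E) :
    contr x (cup a b) = cup (contr x a) b + cup (parity a) (contr x b) := by
  induction a using DirectSum.induction_on with
  | zero => simp
  | add a a' ha ha' => simp only [map_add, LinearMap.add_apply, ha, ha']; abel
  | of p a =>
  induction b using DirectSum.induction_on with
  | zero => simp
  | add b b' hb hb' => simp only [map_add, hb, hb']; abel
  | of q b =>
  refine forms_ext fun n v => ?_
  -- The cup product is only known up to the factor `p! q!`, which is cancelled here.
  rw [← (nsmul_right_injective (M := E)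
    (mul_ne_zero p.factorial_ne_zero q.factorial_ne_zero)).eq_iff]
  dsimp only
  rw [contr_apply]
  by_cases h : p + q = n + 1
  · rw [factorial_smul_cup_apply h, permSum_vecCons]
  -- Outside of the total degree all terms vanish.
  · have h1 : cup (contr x (DirectSum.of (fun m => L [⋀^Fin m]→ₗ[A] E) p a))
        (DirectSum.of (fun m => L [⋀^Fin m]→ₗ[A] E) q b) n = 0 := by
      cases p with
      | zero => rw [contr_of_zero, map_zero, LinearMap.zero_apply]; rfl
      | succ p => rw [contr_of_succ, cup_of, DirectSum.of_eq_of_ne _ _ _ (by omega)]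
    have h2 : cup (parity (DirectSum.of (fun m => L [⋀^Fin m]→ₗ[A] E) p a))
        (contr x (DirectSum.of (fun m => L [⋀^Fin m]→ₗ[A] E) q b)) n = 0 := by
      cases q with
      | zero => rw [contr_of_zero, map_zero]; rfl
      | succ q =>
        rw [contr_of_succ, parity_of, map_zsmul, LinearMap.smul_apply, forms_zsmul_apply, cup_of,
          DirectSum.of_eq_of_ne _ _ _ (by omega), smul_zero]
    rw [cup_of, DirectSum.of_eq_of_ne _ _ _ (Ne.symm h), DirectSum.add_apply, h1, h2]
    simp

theorem cup_apply_zero (a b : Forms A L E) (v : Fin 0 → L) :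
    cup a b 0 v = a 0 v * b 0 v := by
  induction a using DirectSum.induction_on with
  | zero => simp
  | add a a' h h' => simp [h, h', add_mul]
  | of p a =>
    induction b using DirectSum.induction_on with
    | zero => simp
    | add b b' h h' => simp [h, h', mul_add]
    | of q b =>
      by_cases h : p = 0 ∧ q = 0
      · obtain ⟨rfl, rfl⟩ := h
        have := factorial_smul_cup_apply (zero_add 0) a b v
        simp only [permSum, Nat.factorial_zero, mul_one, one_smul] at this
        rw [this, DirectSum.of_eq_same, DirectSum.of_eq_same, Fintype.sum_unique]
        simp [Subsingleton.elim _ v]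
      · have h0 : ∀ {m : ℕ} (ω : L [⋀^Fin m]→ₗ[A] E), m ≠ 0 →
            DirectSum.of (fun m => L [⋀^Fin m]→ₗ[A] E) m ω 0 v = 0 := fun ω hm => by
          rw [DirectSum.of_eq_of_ne _ _ _ hm.symm, AlternatingMap.zero_apply]
        rw [cup_of, h0 _ (by omega)]
        rcases not_and_or.mp h with h | h
        · rw [h0 a h, zero_mul]
        · rw [h0 b h, mul_zero]

theorem parity_cup (a b : Forms A L E) : parity (cup a b) = cup (parity a) (parity b) := by
  induction a using DirectSum.induction_on with
  | zero => simp
  | add a a' h h' => simp [h, h']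
  | of p a =>
    induction b using DirectSum.induction_on with
    | zero => simp
    | add b b' h h' => simp [h, h']
    | of q b =>
      simp only [cup_of, parity_of, map_zsmul, LinearMap.smul_apply, smul_smul, pow_add, mul_comm]

end CupContr

/-! ### The algebra of forms -/

section Algebra

variable {A L E : Type*} [CommRing A] [AddCommGroup L] [Module A L] [Ring E] [Algebra A E]

theorem contr_cupPow_zero (ω : Forms A L E) (x : L) : contr x (cupPow ω 0) = 0 :=
  contr_of_zero x _

theorem parity_cupPow_zero (ω : Forms A L E) : parity (cupPow ω 0) = cupPow ω 0 := by
  rw [cupPow, parity_of, pow_zero, one_smul]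

theorem cupPow_zero_apply (ω : Forms A L E) (v : Fin 0 → L) : cupPow ω 0 0 v = 1 := by
  rw [cupPow, DirectSum.of_eq_same]
  rfl

theorem parity_cupPow {ω : Forms A L E} (h : parity ω = ω) (n : ℕ) :
    parity (cupPow ω n) = cupPow ω n := by
  induction n with
  | zero => exact parity_cupPow_zero ω
  | succ n ih => rw [cupPow, parity_cup, ih, h]

variable [IsAddTorsionFree E]

/-- Induction on the degree of `c`; for fixed `c`, contraction reduces the degrees of `a` and `b` by
`forms_induction₂`. -/
theorem cup_assoc (a b c : Forms A L E) : cup (cup a b) c = cup a (cup b c) := by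
  suffices H : ∀ r (c : L [⋀^Fin r]→ₗ[A] E) (a b : Forms A L E),
      cup (cup a b) (DirectSum.of (fun m => L [⋀^Fin m]→ₗ[A] E) r c) -
        cup a (cup b (DirectSum.of (fun m => L [⋀^Fin m]→ₗ[A] E) r c)) = 0 by
    induction c using DirectSum.induction_on with
    | zero => simp
    | add c c' hc hc' => simp only [map_add, hc, hc']
    | of r c => exact sub_eq_zero.mp (H r c a b)
  intro r
  induction r with
  | zero =>
    intro c
    refine forms_induction₂ _ (by intros; simp; abel) (by intros; simp; abel)
      (fun a b => ?_) (fun x a b h1 h2 => ?_)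
    · ext v
      simp [cup_apply_zero, mul_assoc]
    · rw [sub_eq_zero] at h1 h2
      simp only [map_sub, contr_cup, map_add, LinearMap.add_apply, h1, h2, contr_of_zero, map_zero]
      abel
  | succ r ih =>
    intro c
    refine forms_induction₂ _ (by intros; simp; abel) (by intros; simp; abel)
      (fun a b => ?_) (fun x a b h1 h2 => ?_)
    · ext v
      simp [cup_apply_zero, mul_assoc]
    · rw [sub_eq_zero] at h1 h2
      simp only [map_sub, contr_cup, map_add, LinearMap.add_apply, h1, h2, contr_of_succ,
        parity_cup, sub_eq_zero.mp (ih _ _ _)]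
      abel

theorem cupPow_zero_cup (ω a : Forms A L E) : cup (cupPow ω 0) a = a := by
  refine sub_eq_zero.mp (forms_induction (fun a => cup (cupPow ω 0) a - a)
    (by intros; simp; abel) (fun a => ?_) (fun x a h => ?_) a)
  · ext v
    simp [cup_apply_zero, cupPow_zero_apply]
  · rw [sub_eq_zero] at h
    rw [map_sub, contr_cup, contr_cupPow_zero, parity_cupPow_zero, h]
    simp

theorem cup_cupPow_zero (ω a : Forms A L E) : cup a (cupPow ω 0) = a := by
  refine sub_eq_zero.mp (forms_induction (fun a => cup a (cupPow ω 0) - a)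
    (by intros; simp; abel) (fun a => ?_) (fun x a h => ?_) a)
  · ext v
    simp [cup_apply_zero, cupPow_zero_apply]
  · rw [sub_eq_zero] at h
    rw [map_sub, contr_cup, contr_cupPow_zero, h]
    simp

theorem cup_cupPow (ω : Forms A L E) (n : ℕ) : cup ω (cupPow ω n) = cupPow ω (n + 1) := by
  induction n with
  | zero => exact (cup_cupPow_zero ω ω).trans (cupPow_zero_cup ω ω).symm
  | succ n ih => rw [cupPow, ← cup_assoc, ih, ← cupPow]

end Algebra

/-! ### The trace on forms -/

section TraceForms

variable {A L V : Type*} [CommRing A] [AddCommGroup L] [Module A L] [AddCommGroup V] [Module A V]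
  [Module.Finite A V] [Module.Projective A V]

theorem projTrace_dualTensorHomEquiv (c : Module.Dual A V) (b : V) :
    projTrace A V (dualTensorHomEquiv A V V (c ⊗ₜ b)) = c b := by
  rw [projTrace, LinearMap.comp_apply, LinearEquiv.coe_coe, LinearEquiv.symm_apply_apply,
    contractLeft_apply]

theorem projTrace_mul_comm (φ ψ : Module.End A V) :
    projTrace A V (φ * ψ) = projTrace A V (ψ * φ) := by
  obtain ⟨t, rfl⟩ := (dualTensorHomEquiv A V V).surjective φ
  induction t using TensorProduct.induction_on with
  | zero => simp
  | add t t' h h' => simp only [map_add, add_mul, mul_add, h, h']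
  | tmul c b =>
    have h1 : dualTensorHomEquiv A V V (c ⊗ₜ b) * ψ = dualTensorHomEquiv A V V ((c ∘ₗ ψ) ⊗ₜ b) := by
      ext v; simp [dualTensorHom_apply]
    have h2 : ψ * dualTensorHomEquiv A V V (c ⊗ₜ b) = dualTensorHomEquiv A V V (c ⊗ₜ ψ b) := by
      ext v; simp [dualTensorHom_apply]
    rw [h1, h2, projTrace_dualTensorHomEquiv, projTrace_dualTensorHomEquiv, LinearMap.comp_apply]

theorem traceForms_apply (ω : Forms A L (Module.End A V)) (n : ℕ) (v : Fin n → L) :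
    traceForms ω n v = projTrace A V (ω n v) := by
  rw [traceForms, DirectSum.lmap_apply]
  rfl

theorem contr_traceForms (x : L) (ω : Forms A L (Module.End A V)) :
    contr x (traceForms ω) = traceForms (contr x ω) := by
  refine forms_ext fun n v => ?_
  rw [contr_apply, traceForms_apply, traceForms_apply, contr_apply]

/-- The trace is graded commutative. The sign `(-1)^{pq}` is expressed through the projections
`(a ± parity a) / 2` to even and odd forms. -/
theorem two_smul_traceForms_cup [IsAddTorsionFree (Module.End A V)]
    (a b : Forms A L (Module.End A V)) : (2 : ℤ) • traceForms (cup a b) =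
      traceForms (cup b (a + parity a) + cup (parity b) (a - parity a)) := by
  let F : Forms A L (Module.End A V) → Forms A L (Module.End A V) → Forms A L A := fun a b =>
    (2 : ℤ) • traceForms (cup a b) -
      traceForms (cup b (a + parity a) + cup (parity b) (a - parity a))
  suffices H : F a b = 0 from sub_eq_zero.mp H
  refine forms_induction₂ F (fun a a' b => ?_) (fun a b b' => ?_)
    (fun a b => ?_) (fun x a b h1 h2 => ?_) a b
  · simp only [F, map_add, map_sub, LinearMap.add_apply, smul_add]
    abel
  · simp only [F, map_add, map_sub, LinearMap.add_apply, smul_add]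
    abel
  · ext v
    have hp : ∀ c : Forms A L (Module.End A V), parity c 0 = c 0 := fun c => by
      rw [parity_apply, pow_zero, one_smul]
    simp only [F]
    rw [forms_sub_apply, AlternatingMap.sub_apply, forms_zsmul_apply, AlternatingMap.smul_apply,
      traceForms_apply, traceForms_apply, cup_apply_zero, DirectSum.add_apply,
      AlternatingMap.add_apply, cup_apply_zero, cup_apply_zero, forms_sub_apply, hp,
      DirectSum.add_apply, hp, sub_self, AlternatingMap.zero_apply, mul_zero, add_zero,
      AlternatingMap.add_apply, mul_add, map_add, ← two_zsmul, projTrace_mul_comm, sub_self,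
      AlternatingMap.zero_apply]
  · rw [sub_eq_zero] at h1 h2
    simp only [F]
    rw [map_sub, map_zsmul, contr_traceForms, contr_traceForms, contr_cup, map_add traceForms,
      smul_add, h1, h2]
    simp only [map_add, map_sub, contr_cup, contr_parity, parity_parity, map_neg,
      LinearMap.neg_apply]
    abel

/-- The trace of a product in which the first factor is even is symmetric. -/
theorem traceForms_cup_comm [IsAddTorsionFree (Module.End A V)] [IsAddTorsionFree A]
    {a : Forms A L (Module.End A V)} (ha : parity a = a) (b : Forms A L (Module.End A V)) :
    traceForms (cup a b) = traceForms (cup b a) := by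
  have h := two_smul_traceForms_cup a b
  rw [ha, sub_self, map_zero, add_zero, ← two_zsmul, map_zsmul, map_zsmul] at h
  refine forms_ext fun n v => zsmul_right_injective (G := A) (two_ne_zero (α := ℤ)) ?_
  have h := congr_arg (fun ω : Forms A L A => ω n v) h
  simpa only [forms_zsmul_apply, AlternatingMap.smul_apply] using h

end TraceForms

/-! ### Covariant derivative, Lie derivative and Cartan's formula -/

section Cartan

variable {k A L V : Type*} [Field k] [CommRing A] [Algebra k A]
  [LieRing L] [LieAlgebra k L] [Module A L] [AddCommGroup V] [Module k V] [Module A V]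
  [IsScalarTower k A V]

/-- The part of Cartan's formula that concerns the bracket terms of the Koszul formula. -/
theorem koszulBracket_vecCons {n : ℕ} (ω : L [⋀^Fin (n + 1)]→ₗ[A] V) (x : L)
    (v : Fin (n + 1) → L) : koszulBracket ω (Matrix.vecCons x v) =
      -(∑ j, ω (Function.update v j ⁅x, v j⁆)) - koszulBracket (ω.curryLeft x) v := by
  simp only [koszulBracket]
  rw [Fin.sum_univ_succ, sub_eq_add_neg]
  congr 1
  · have h0 : Finset.Ici (0 : Fin (n + 1)) = Finset.univ := by ext; simp
    rw [h0, ← Finset.sum_neg_distrib]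
    refine Finset.sum_congr rfl fun j _ => ?_
    rw [Fin.castSucc_zero, removeNth_zero_vecCons, Matrix.cons_val_succ, Matrix.cons_val_zero,
      ← Fin.insertNth_removeNth, ω.map_insertNth, Fin.val_zero, zero_add, pow_succ, mul_neg_one,
      neg_smul]
  · cases n with
    | zero => simp
    | succ n =>
    rw [← Finset.sum_neg_distrib]
    refine Finset.sum_congr rfl fun i _ => ?_
    rw [← Finset.sum_neg_distrib]
    refine (Finset.sum_bij (fun j _ => Fin.succ j) ?_ ?_ ?_ ?_).symm
    · intro j hj; simpa using hj
    · intro j _ j' _ h; exact Fin.succ_injective _ h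
    · intro j hj
      have hj0 : j ≠ 0 := fun h => by
        subst h
        simp at hj
      obtain ⟨j, rfl⟩ := Fin.exists_succ_eq.mpr hj0
      exact ⟨j, by simpa using hj, rfl⟩
    · intro j _
      rw [← Fin.succ_castSucc, removeNth_succ_vecCons, removeNth_succ_vecCons,
        Matrix.cons_val_succ, Matrix.cons_val_succ, AlternatingMap.curryLeft_apply_apply,
        ← smul_neg]
      congr 1
      · simp only [Fin.val_succ]
        ring
      -- Moving `x` past the bracket in the arguments of `ω` costs a sign.
      · have := ω.map_swap (Matrix.vecCons x (Matrix.vecCons ⁅v i.castSucc, v j.succ⁆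
          (j.removeNth (i.castSucc.removeNth v)))) (Fin.zero_ne_one (n := n))
        rw [← this]
        congr 1
        ext p
        refine Fin.cases ?_ (fun p => Fin.cases ?_ (fun p => ?_) p) p
        · simp
        · simp
        · rw [Function.comp_apply, Equiv.swap_apply_of_ne_of_ne (Fin.succ_ne_zero _)
            (by simp [Fin.ext_iff])]
          simp

variable [CharZero k] [LieRingModule L A] [LieRinehartRing A L] [LieRinehartAlgebra k A L]

/-- The covariant derivative on the total space of forms. -/
def covD (D : LConnection k A L V) : Forms A L V →ₗ[k] Forms A L V :=
  DirectSum.toModule k ℕ _ fun m =>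
    DirectSum.lof k ℕ (fun m => L [⋀^Fin m]→ₗ[A] V) (m + 1) ∘ₗ covDeriv D m

theorem covD_of (D : LConnection k A L V) {m : ℕ} (ω : L [⋀^Fin m]→ₗ[A] V) :
    covD D (DirectSum.of (fun m => L [⋀^Fin m]→ₗ[A] V) m ω) =
      DirectSum.of (fun m => L [⋀^Fin m]→ₗ[A] V) (m + 1) (covDeriv D m ω) := by
  rw [← DirectSum.lof_eq_of k, covD, DirectSum.toModule_lof]
  rfl

theorem covD_apply_zero (D : LConnection k A L V) (ω : Forms A L V) : covD D ω 0 = 0 := by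
  induction ω using DirectSum.induction_on with
  | zero => simp
  | add ω ω' h h' => simp [h, h']
  | of m ω => rw [covD_of, DirectSum.of_eq_of_ne _ _ _ (Nat.succ_ne_zero m).symm]

theorem covD_apply_succ (D : LConnection k A L V) (ω : Forms A L V) (n : ℕ) :
    covD D ω (n + 1) = covDeriv D n (ω n) := by
  induction ω using DirectSum.induction_on with
  | zero => simp
  | add ω ω' h h' => simp [h, h']
  | of m ω =>
    rw [covD_of]
    by_cases h : n = m
    · subst h
      rw [DirectSum.of_eq_same, DirectSum.of_eq_same]
    · rw [DirectSum.of_eq_of_ne _ _ _ h, DirectSum.of_eq_of_ne _ _ _ (by simpa using h), map_zero]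

theorem covD_parity (D : LConnection k A L V) (ω : Forms A L V) :
    covD D (parity ω) = -parity (covD D ω) := by
  refine DFinsupp.ext fun n => ?_
  cases n with
  | zero => simp [forms_neg_apply, parity_apply, covD_apply_zero]
  | succ n =>
    rw [forms_neg_apply, parity_apply, covD_apply_succ, covD_apply_succ, parity_apply, map_zsmul,
      pow_succ]
    simp

/-- The Lie derivative along `x`, defined by Cartan's formula. -/
def lieD (D : LConnection k A L V) (x : L) (ω : Forms A L V) : Forms A L V :=
  contr x (covD D ω) + covD D (contr x ω)

theorem lieD_add (D : LConnection k A L V) (x : L) (ω ω' : Forms A L V) :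
    lieD D x (ω + ω') = lieD D x ω + lieD D x ω' := by
  simp only [lieD, map_add]
  abel

theorem contr_covD (D : LConnection k A L V) (x : L) (ω : Forms A L V) :
    contr x (covD D ω) = lieD D x ω - covD D (contr x ω) := by
  rw [lieD, add_sub_cancel_right]

theorem lieD_parity (D : LConnection k A L V) (x : L) (ω : Forms A L V) :
    lieD D x (parity ω) = parity (lieD D x ω) := by
  simp only [lieD, map_add, covD_parity, contr_parity, map_neg, neg_neg]

/-- The Lie derivative in terms of values. -/
theorem lieD_apply (D : LConnection k A L V) (x : L) (ω : Forms A L V) (n : ℕ) (v : Fin n → L) :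
    lieD D x ω n v =
      D.toLinearMap x (ω n v) - ∑ j, ω n (Function.update v j ⁅x, v j⁆) := by
  rw [lieD, DirectSum.add_apply, AlternatingMap.add_apply, contr_apply, covD_apply_succ]
  change koszul D (ω n) (Matrix.vecCons x v) + _ = _
  cases n with
  | zero =>
    rw [covD_apply_zero]
    simp [koszul, koszulBracket]
  | succ n =>
    have h : contr x ω n = (ω (n + 1)).curryLeft x := by
      ext w
      exact contr_apply x ω n w
    rw [covD_apply_succ, h]
    change _ + koszul D ((ω (n + 1)).curryLeft x) v = _
    rw [koszul, koszul, koszulBracket_vecCons, Fin.sum_univ_succ, removeNth_zero_vecCons]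
    simp only [removeNth_succ_vecCons, Matrix.cons_val_zero, Matrix.cons_val_succ, Fin.val_zero,
      pow_zero, one_smul, Fin.val_succ, pow_succ, mul_neg_one, neg_smul, Finset.sum_neg_distrib,
      AlternatingMap.curryLeft_apply_apply]
    abel

/-- The commutator of Lie derivatives and contractions. -/
theorem contr_lieD (D : LConnection k A L V) (x y : L) (ω : Forms A L V) :
    contr y (lieD D x ω) = lieD D x (contr y ω) - contr ⁅x, y⁆ ω := by
  refine forms_ext fun n v => ?_
  rw [forms_sub_apply, AlternatingMap.sub_apply, contr_apply, lieD_apply, lieD_apply,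
    contr_apply, contr_apply, Fin.sum_univ_succ, sub_sub, add_comm (ω (n + 1) _)]
  congr 2
  · refine Finset.sum_congr rfl fun j _ => ?_
    rw [contr_apply, Matrix.cons_val_succ]
    congr 1
    exact (Fin.cons_update (α := fun _ => L) y v j _).symm
  · congr 1
    exact Fin.update_cons_zero (α := fun _ => L) y v _

end Cartan

section Leibniz

variable {k A L E : Type*} [Field k] [CharZero k] [CommRing A] [Algebra k A]
  [LieRing L] [LieAlgebra k L] [Module A L] [LieRingModule L A] [LieRinehartRing A L]
  [LieRinehartAlgebra k A L] [Ring E] [Algebra A E] [Module k E] [IsScalarTower k A E]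
  [IsAddTorsionFree E]

/-- The Lie derivative is a derivation of the cup product. -/
theorem lieD_cup {D : LConnection k A L E}
    (hD : ∀ X a b, D.toLinearMap X (a * b) = D.toLinearMap X a * b + a * D.toLinearMap X b)
    (x : L) (a b : Forms A L E) :
    lieD D x (cup a b) = cup (lieD D x a) b + cup a (lieD D x b) := by
  refine sub_eq_zero.mp (forms_induction₂
    (fun a b => lieD D x (cup a b) - (cup (lieD D x a) b + cup a (lieD D x b)))
    (by intros; simp [lieD_add]; abel) (by intros; simp [lieD_add]; abel)
    (fun a b => ?_) (fun y a b h1 h2 => ?_) a b)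
  · ext v
    rw [forms_sub_apply, AlternatingMap.sub_apply, lieD_apply, DirectSum.add_apply,
      AlternatingMap.add_apply, cup_apply_zero, cup_apply_zero, cup_apply_zero, lieD_apply,
      lieD_apply, hD]
    simp
  · rw [sub_eq_zero] at h1 h2
    simp only [map_sub, map_add, contr_lieD, contr_cup, lieD_add, h1, h2, LinearMap.sub_apply,
      lieD_parity]
    abel

/-- The graded Leibniz rule for the covariant derivative. -/
theorem covD_cup {D : LConnection k A L E}
    (hD : ∀ X a b, D.toLinearMap X (a * b) = D.toLinearMap X a * b + a * D.toLinearMap X b)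
    (a b : Forms A L E) :
    covD D (cup a b) = cup (covD D a) b + cup (parity a) (covD D b) := by
  refine sub_eq_zero.mp (forms_induction₂
    (fun a b => covD D (cup a b) - (cup (covD D a) b + cup (parity a) (covD D b)))
    (by intros; simp; abel) (by intros; simp; abel)
    (fun a b => ?_) (fun x a b h1 h2 => ?_) a b)
  · ext v
    rw [forms_sub_apply, covD_apply_zero, DirectSum.add_apply, AlternatingMap.sub_apply,
      AlternatingMap.add_apply, cup_apply_zero, cup_apply_zero, covD_apply_zero, covD_apply_zero]
    simp
  · rw [sub_eq_zero] at h1 h2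
    simp only [map_sub, map_add, contr_covD, contr_cup, lieD_cup hD, h1, h2, LinearMap.sub_apply,
      covD_parity, contr_parity, parity_parity, map_neg, LinearMap.neg_apply]
    abel

end Leibniz

/-! ### Polynomial families and their derivatives -/

section PolyDeriv

variable (k M : Type*) [Field k] [AddCommGroup M] [Module k M]

/-- The pairs `(ω, dω/ds)` of a family `k → M` that depends polynomially on its parameter `s`, and
its formal derivative. -/
def polyDerivPairs : Submodule k ((k → M) × (k → M)) :=
  Submodule.span k (Set.range fun nm : ℕ × M =>
    ((fun s => s ^ nm.1 • nm.2), (fun s => ((nm.1 : k) * s ^ (nm.1 - 1)) • nm.2)))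

variable {k M} {N P : Type*} [AddCommGroup N] [Module k N] [AddCommGroup P] [Module k P]

theorem monomial_mem_polyDerivPairs (n : ℕ) (m : M) :
    ((fun s : k => s ^ n • m), (fun s : k => ((n : k) * s ^ (n - 1)) • m)) ∈
      polyDerivPairs k M :=
  Submodule.subset_span ⟨(n, m), rfl⟩

theorem const_mem_polyDerivPairs (m : M) :
    ((fun _ : k => m), (fun _ : k => (0 : M))) ∈ polyDerivPairs k M := by
  simpa using monomial_mem_polyDerivPairs (k := k) 0 m

theorem map_mem_polyDerivPairs (g : M →ₗ[k] N) {ω ω' : k → M}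
    (h : (ω, ω') ∈ polyDerivPairs k M) :
    ((fun s => g (ω s)), (fun s => g (ω' s))) ∈ polyDerivPairs k N := by
  have := Submodule.apply_mem_span_image_of_mem_span
    ((LinearMap.compLeft g k).prodMap (LinearMap.compLeft g k)) h
  refine Submodule.span_mono ?_ this
  rintro _ ⟨_, ⟨⟨n, m⟩, rfl⟩, rfl⟩
  refine ⟨(n, g m), ?_⟩
  ext s <;> simp

/-- The product rule. -/
theorem mul_mem_polyDerivPairs (B : M →ₗ[k] N →ₗ[k] P) {a a' : k → M} {b b' : k → N}
    (ha : (a, a') ∈ polyDerivPairs k M) (hb : (b, b') ∈ polyDerivPairs k N) :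
    ((fun s => B (a s) (b s)), (fun s => B (a' s) (b s) + B (a s) (b' s))) ∈
      polyDerivPairs k P := by
  suffices H : ∀ x ∈ polyDerivPairs k M, ∀ y ∈ polyDerivPairs k N,
      ((fun s => B (x.1 s) (y.1 s)), (fun s => B (x.2 s) (y.1 s) + B (x.1 s) (y.2 s))) ∈
        polyDerivPairs k P from H _ ha _ hb
  intro x hx y hy
  induction hx, hy using Submodule.span_induction₂ with
  | mem_mem x y hx hy =>
    obtain ⟨⟨n, m⟩, rfl⟩ := hx
    obtain ⟨⟨n', m'⟩, rfl⟩ := hy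
    convert monomial_mem_polyDerivPairs (k := k) (n + n') (B m m') using 2
    · ext s
      simp only [map_smul, LinearMap.smul_apply, smul_smul, pow_add, mul_comm]
    · ext s
      simp only [map_smul, LinearMap.smul_apply, smul_smul, ← add_smul]
      congr 1
      rcases n with _ | n <;> rcases n' with _ | n' <;> (simp; try ring)
  | zero_left y _ => convert zero_mem (polyDerivPairs k P) using 1; ext s <;> simp
  | zero_right x _ => convert zero_mem (polyDerivPairs k P) using 1; ext s <;> simp
  | add_left x x' y _ _ _ h h' =>
    convert add_mem h h' using 1
    ext s
    · simp
    · simp; abel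
  | add_right x y y' _ _ _ h h' =>
    convert add_mem h h' using 1
    ext s
    · simp
    · simp; abel
  | smul_left c x y _ _ h =>
    convert Submodule.smul_mem _ c h using 1
    ext s <;> simp
  | smul_right c x y _ _ h =>
    convert Submodule.smul_mem _ c h using 1
    ext s <;> simp

theorem isPolynomialFamily_of_mem {ω ω' : k → M} (h : (ω, ω') ∈ polyDerivPairs k M) :
    IsPolynomialFamily ω := by
  suffices H : ∀ x ∈ polyDerivPairs k M, IsPolynomialFamily x.1 from H _ h
  intro x hx
  induction hx using Submodule.span_induction with
  | mem x hx =>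
    obtain ⟨⟨n, m⟩, rfl⟩ := hx
    exact ⟨PolynomialModule.single k n m, fun s => PolynomialModule.eval_single s n m⟩
  | zero => exact ⟨0, fun s => by simp⟩
  | add x y _ _ hx hy =>
    obtain ⟨p, hp⟩ := hx
    obtain ⟨q, hq⟩ := hy
    exact ⟨p + q, fun s => by simp [hp, hq]⟩
  | smul c x _ hx =>
    obtain ⟨p, hp⟩ := hx
    exact ⟨c • p, fun s => by simp [hp]⟩

theorem polyIntegral_add (p q : PolynomialModule k M) :
    polyIntegral (p + q) = polyIntegral p + polyIntegral q := by
  rw [polyIntegral, PolynomialModule.coeff_add, Finsupp.sum_add_index'] <;>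
    simp [polyIntegral]

theorem polyIntegral_single (n : ℕ) (m : M) :
    polyIntegral (PolynomialModule.single k n m) = ((n : k) + 1)⁻¹ • m := by
  rw [polyIntegral, PolynomialModule.coeff_single, Finsupp.sum_single_index (by simp)]

theorem polyIntegral_smul (c : k) (p : PolynomialModule k M) :
    polyIntegral (c • p) = c • polyIntegral p := by
  induction p using PolynomialModule.induction_linear with
  | zero => simp [polyIntegral]
  | add p q hp hq => rw [smul_add, polyIntegral_add, polyIntegral_add, hp, hq, smul_add]
  | single n m =>
    rw [← PolynomialModule.single_smul, polyIntegral_single, polyIntegral_single, smul_comm]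

/-- The fundamental theorem of calculus for polynomial families. -/
theorem integral01_of_mem [CharZero k] {ω ω' : k → M} (h : (ω, ω') ∈ polyDerivPairs k M) :
    integral01 ω' = ω 1 - ω 0 := by
  suffices H : ∀ x ∈ polyDerivPairs k M, ∃ p : PolynomialModule k M,
      (∀ s, PolynomialModule.eval s p = x.2 s) ∧ polyIntegral p = x.1 1 - x.1 0 by
    obtain ⟨p, hp, hp'⟩ := H _ h
    rw [integral01_eq p hp, hp']
  intro x hx
  induction hx using Submodule.span_induction with
  | mem x hx =>
    obtain ⟨⟨n, m⟩, rfl⟩ := hx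
    refine ⟨PolynomialModule.single k (n - 1) ((n : k) • m), fun s => ?_, ?_⟩
    · rw [PolynomialModule.eval_single, smul_smul, mul_comm]
    · rw [polyIntegral_single]
      cases n with
      | zero => simp
      | succ n =>
        have : ((n : k) + 1) ≠ 0 := Nat.cast_add_one_ne_zero n
        simp [smul_smul, this]
  | zero => exact ⟨0, fun s => by simp, by simp [polyIntegral]⟩
  | add x y _ _ hx hy =>
    obtain ⟨p, hp, hp'⟩ := hx
    obtain ⟨q, hq, hq'⟩ := hy
    refine ⟨p + q, fun s => by simp [hp, hq], ?_⟩
    rw [polyIntegral_add, hp', hq']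
    simp only [Prod.fst_add, Pi.add_apply]
    abel
  | smul c x _ hx =>
    obtain ⟨p, hp, hp'⟩ := hx
    refine ⟨c • p, fun s => by simp [hp], ?_⟩
    rw [polyIntegral_smul, hp', smul_sub]
    rfl

/-- Polynomial families have primitives. -/
theorem exists_primitive [CharZero k] {ω : k → M} (h : IsPolynomialFamily ω) :
    ∃ Ω, (Ω, ω) ∈ polyDerivPairs k M := by
  obtain ⟨p, hp⟩ := h
  obtain rfl : (fun s => PolynomialModule.eval s p) = ω := funext hp
  clear hp
  induction p using PolynomialModule.induction_linear with
  | zero => exact ⟨0, by convert zero_mem (polyDerivPairs k M) using 1; ext s <;> simp⟩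
  | add p q hp hq =>
    obtain ⟨P, hP⟩ := hp
    obtain ⟨Q, hQ⟩ := hq
    exact ⟨P + Q, by convert add_mem hP hQ using 1; ext s <;> simp⟩
  | single n m =>
    have h := monomial_mem_polyDerivPairs (k := k) (n + 1) (((n : k) + 1)⁻¹ • m)
    have hn : ((n : k) + 1) ≠ 0 := Nat.cast_add_one_ne_zero n
    refine ⟨fun s => s ^ (n + 1) • ((n : k) + 1)⁻¹ • m, ?_⟩
    convert h using 2
    ext s
    rw [PolynomialModule.eval_single, smul_smul, add_tsub_cancel_right, Nat.cast_succ,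
      mul_right_comm, mul_inv_cancel₀ hn, one_mul]

/-- Integration over the parameter commutes with linear maps. -/
theorem integral01_map [CharZero k] (g : M →ₗ[k] N) {ω : k → M} (h : IsPolynomialFamily ω) :
    integral01 (fun s => g (ω s)) = g (integral01 ω) := by
  obtain ⟨Ω, hΩ⟩ := exists_primitive h
  rw [integral01_of_mem hΩ, integral01_of_mem (map_mem_polyDerivPairs g hΩ), map_sub]

end PolyDeriv

/-! ### One-forms -/

section OneForm

variable {A L V : Type*} [CommRing A] [LieRing L] [Module A L] [AddCommGroup V] [Module A V]

theorem parity_oneForm (η : L →ₗ[A] Module.End A V) :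
    parity (oneForm A η) = -oneForm A η := by
  rw [oneForm, parity_of]
  simp

theorem oneForm_apply (η : L →ₗ[A] Module.End A V) (x : L) : oneForm A η 1 ![x] = η x := by
  rw [oneForm, DirectSum.of_eq_same]
  simp

theorem oneForm_cup_oneForm_apply_of_ne (η θ : L →ₗ[A] Module.End A V) {n : ℕ} (hn : n ≠ 2) :
    cup (oneForm A η) (oneForm A θ) n = 0 := by
  rw [oneForm, oneForm, cup_of, DirectSum.of_eq_of_ne _ _ _ hn]

theorem oneForm_cup_oneForm_apply [IsAddTorsionFree (Module.End A V)]
    (η θ : L →ₗ[A] Module.End A V) (x y : L) :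
    cup (oneForm A η) (oneForm A θ) 2 ![x, y] = η x * θ y - η y * θ x := by
  have hc : ∀ (η : L →ₗ[A] Module.End A V) z w, contr w (contr z (oneForm A η)) = 0 :=
    fun η z w => by rw [oneForm, contr_of_succ, contr_of_zero]
  have hp : ∀ z, parity (contr z (oneForm A η)) = contr z (oneForm A η) := fun z => by
    rw [oneForm, contr_of_succ, parity_of, pow_zero, one_smul]
  have h0 : ∀ (η : L →ₗ[A] Module.End A V) z, contr z (oneForm A η) 0 ![] = η z := fun η z => by
    rw [contr_apply, oneForm_apply]
  rw [← contr_apply, ← contr_apply, contr_cup, map_add, contr_cup, contr_cup, hc, hc, hp,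
    parity_oneForm, map_neg, map_zero, map_zero, LinearMap.zero_apply, zero_add, add_zero,
    DirectSum.add_apply, AlternatingMap.add_apply, cup_apply_zero, cup_apply_zero, forms_neg_apply,
    AlternatingMap.neg_apply, h0, h0, h0, h0, neg_mul, sub_eq_add_neg]

end OneForm

/-! ### The connection on endomorphisms -/

section EndConnection

variable {k A L V : Type*} [Field k] [CommRing A] [Algebra k A]
  [LieRing L] [LieAlgebra k L] [Module A L] [LieRingModule L A] [LieRinehartRing A L]
  [LieRinehartAlgebra k A L] [AddCommGroup V] [Module k V] [Module A V] [IsScalarTower k A V]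

/-- The connection `φ ↦ [∇_X, φ]` on `End V` induced by a connection on `V`. -/
def endConn (D : LConnection k A L V) : LConnection k A L (Module.End A V) where
  toLinearMap :=
    { toFun := fun X =>
        { toFun := fun φ =>
            { toFun := fun v => D.toLinearMap X (φ v) - φ (D.toLinearMap X v)
              map_add' := fun v w => by simp only [map_add]; abel
              map_smul' := fun a v => by
                simp only [map_smul, D.leibniz, map_add, RingHom.id_apply, smul_sub]
                abel }
          map_add' := fun φ ψ => by ext v; simp; abel
          map_smul' := fun c φ => by
            ext v
            simp [smul_sub] }
      map_add' := fun X Y => by ext φ v; simp; abel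
      map_smul' := fun a X => by ext φ v; simp [smul_sub] }
  leibniz X a φ := by
    ext v
    simp [D.leibniz, smul_sub, add_sub_assoc]

omit [LieAlgebra k L] [LieRinehartRing A L] [LieRinehartAlgebra k A L] in
theorem endConn_apply (D : LConnection k A L V) (X : L) (φ : Module.End A V) (v : V) :
    (endConn D).toLinearMap X φ v = D.toLinearMap X (φ v) - φ (D.toLinearMap X v) :=
  rfl

omit [LieAlgebra k L] [LieRinehartRing A L] [LieRinehartAlgebra k A L] in
theorem endConn_mul (D : LConnection k A L V) (X : L) (φ ψ : Module.End A V) :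
    (endConn D).toLinearMap X (φ * ψ) =
      (endConn D).toLinearMap X φ * ψ + φ * (endConn D).toLinearMap X ψ := by
  ext v
  simp [endConn_apply]

omit [LieAlgebra k L] [LieRinehartRing A L] [LieRinehartAlgebra k A L] in
theorem endConn_one (D : LConnection k A L V) (X : L) : (endConn D).toLinearMap X 1 = 0 := by
  ext v
  simp [endConn_apply]

omit [LieAlgebra k L] [LieRinehartAlgebra k A L] in
/-- The trace is parallel: `trace [∇_X, φ] = X (trace φ)`. In a coordinate system `(bᵢ, cᵢ)` the
difference of the two sides is the trace of `φ` composed with the covariant derivative of the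
identity `∑ cᵢ ⊗ bᵢ`. -/
theorem projTrace_endConn [Module.Finite A V] [Module.Projective A V] (D : LConnection k A L V)
    (X : L) (φ : Module.End A V) :
    projTrace A V ((endConn D).toLinearMap X φ) = ⁅X, projTrace A V φ⁆ := by
  obtain ⟨n, f, hf⟩ := Module.Finite.exists_fin' A V
  obtain ⟨g, hg⟩ := Module.projective_lifting_property f LinearMap.id hf
  let b : Fin n → V := fun i => f (Pi.single i 1)
  let c : Fin n → Module.Dual A V := fun i => LinearMap.proj i ∘ₗ g
  have hbc : ∀ v, ∑ i, c i v • b i = v := fun v => by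
    have hv : f (g v) = v := DFunLike.congr_fun hg v
    conv_rhs => rw [← hv, pi_eq_sum_univ' (g v), map_sum]
    refine Finset.sum_congr rfl fun i _ => ?_
    rw [map_smul]
    congr 2
  -- The dual connection, applied to the coordinate functions.
  let dc : Fin n → Module.Dual A V := fun i =>
    { toFun := fun v => ⁅X, c i v⁆ - c i (D.toLinearMap X v)
      map_add' := fun v w => by simp only [map_add, lie_add]; abel
      map_smul' := fun a v => by
        simp only [map_smul, D.leibniz, map_add, RingHom.id_apply, smul_eq_mul, mul_sub,
          LieRinehartRing.leibniz_mul_right]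
        ring }
  have hdc : ∀ i v, dc i v = ⁅X, c i v⁆ - c i (D.toLinearMap X v) := fun _ _ => rfl
  -- The covariant derivative of the identity `∑ cᵢ ⊗ bᵢ` vanishes.
  have h0 : ∀ v, ∑ i, (dc i v • b i + c i v • D.toLinearMap X (b i)) = 0 := fun v => by
    have h := congr_arg (D.toLinearMap X) (hbc v)
    rw [map_sum, ← hbc (D.toLinearMap X v), ← sub_eq_zero, ← Finset.sum_sub_distrib] at h
    rw [← h]
    refine Finset.sum_congr rfl fun i _ => ?_
    rw [D.leibniz, hdc, sub_smul]
    abel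
  have h1 : ∑ i, (dualTensorHomEquiv A V V (dc i ⊗ₜ φ (b i)) +
      dualTensorHomEquiv A V V (c i ⊗ₜ φ (D.toLinearMap X (b i)))) = 0 := by
    ext v
    have h := congr_arg φ (h0 v)
    simp only [map_sum, map_add, map_smul, map_zero] at h
    simpa [dualTensorHom_apply] using h
  have h2 := congr_arg (projTrace A V) h1
  simp only [map_sum, map_add, projTrace_dualTensorHomEquiv, map_zero, hdc] at h2
  rw [projTrace_eq_sum b c hbc, projTrace_eq_sum b c hbc, lie_sum, ← sub_eq_zero,
    ← Finset.sum_sub_distrib, ← neg_eq_zero, ← Finset.sum_neg_distrib, ← h2]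
  refine Finset.sum_congr rfl fun i _ => ?_
  rw [endConn_apply, map_sub]
  abel

/-- The trace intertwines the covariant derivative of `End V`-valued forms and the de Rham
differential. -/
theorem dDR_traceForms [CharZero k] [Module.Finite A V] [Module.Projective A V]
    (D : LConnection k A L V) (ω : Forms A L (Module.End A V)) :
    dDR k A L (traceForms ω) = traceForms (covD (endConn D) ω) := by
  change covD (LConnection.canonical k A L) (traceForms ω) = _
  have hl : ∀ x (ω : Forms A L (Module.End A V)),
      lieD (LConnection.canonical k A L) x (traceForms ω) = traceForms (lieD (endConn D) x ω) := by
    refine fun x ω => forms_ext fun n v => ?_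
    rw [lieD_apply, traceForms_apply, traceForms_apply, lieD_apply, map_sub, map_sum,
      projTrace_endConn]
    simp only [traceForms_apply]
    rfl
  refine sub_eq_zero.mp (forms_induction (fun ω => covD (LConnection.canonical k A L)
    (traceForms ω) - traceForms (covD (endConn D) ω)) (by intros; simp; abel) (fun ω => ?_)
    (fun x ω h => ?_) ω)
  · ext v
    rw [forms_sub_apply, covD_apply_zero, AlternatingMap.sub_apply, traceForms_apply,
      covD_apply_zero]
    simp
  · rw [sub_eq_zero] at h
    rw [map_sub, contr_covD, contr_traceForms, contr_traceForms, contr_covD, map_sub, h, hl,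
      sub_self]

/-! ### The Bianchi identity and the variation of the curvature -/

/-- The curvature as an element of the total space of forms. -/
def curvForm (D : LConnection k A L V) : Forms A L (Module.End A V) :=
  DirectSum.of (fun m => L [⋀^Fin m]→ₗ[A] Module.End A V) 2 D.curvature

omit [LieAlgebra k L] [LieRinehartAlgebra k A L] in
theorem curvForm_apply (D : LConnection k A L V) (x y : L) :
    curvForm D 2 ![x, y] = D.curvatureEnd x y := by
  rw [curvForm, DirectSum.of_eq_same]
  rfl

omit [LieAlgebra k L] [LieRinehartAlgebra k A L] in
theorem parity_curvForm (D : LConnection k A L V) : parity (curvForm D) = curvForm D := by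
  rw [curvForm, parity_of]
  simp

variable [CharZero k]

theorem covD_apply_vecCons (D : LConnection k A L V) (ω : Forms A L V) (n : ℕ) (x : L)
    (v : Fin n → L) : covD D ω (n + 1) (Matrix.vecCons x v) =
      D.toLinearMap x (ω n v) - ∑ j, ω n (Function.update v j ⁅x, v j⁆) -
        covD D (contr x ω) n v := by
  rw [← lieD_apply, ← contr_apply, contr_covD]
  rw [forms_sub_apply, AlternatingMap.sub_apply]

theorem covD_apply_one (D : LConnection k A L V) (ω : Forms A L V) (x : L) :
    covD D ω 1 ![x] = D.toLinearMap x (ω 0 ![]) := by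
  rw [covD_apply_vecCons, covD_apply_zero]
  simp

theorem covD_apply_two (D : LConnection k A L V) (ω : Forms A L V) (x y : L) :
    covD D ω 2 ![x, y] = D.toLinearMap x (ω 1 ![y]) - ω 1 ![⁅x, y⁆] -
      D.toLinearMap y (ω 1 ![x]) := by
  rw [covD_apply_vecCons, covD_apply_one, contr_apply, Fin.sum_univ_one]
  congr 3
  ext i
  fin_cases i
  rfl

theorem covD_apply_three (D : LConnection k A L V) (ω : Forms A L V) (x y z : L) :
    covD D ω 3 ![x, y, z] =
      D.toLinearMap x (ω 2 ![y, z]) - (ω 2 ![⁅x, y⁆, z] + ω 2 ![y, ⁅x, z⁆]) -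
        (D.toLinearMap y (ω 2 ![x, z]) - ω 2 ![x, ⁅y, z⁆] - D.toLinearMap z (ω 2 ![x, y])) := by
  rw [covD_apply_vecCons, covD_apply_two, contr_apply, contr_apply, contr_apply,
    Fin.sum_univ_two]
  congr 4 <;>
  · ext i
    fin_cases i <;> rfl

/-- The Bianchi identity. -/
theorem covD_curvForm (D : LConnection k A L V) : covD (endConn D) (curvForm D) = 0 := by
  refine forms_ext_of_degree (m := 3) (fun n hn => ?_) (fun n _ => rfl) (fun v => ?_)
  · rw [curvForm, covD_of, DirectSum.of_eq_of_ne _ _ _ hn]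
  · obtain ⟨x, y, z, rfl⟩ : ∃ x y z, v = ![x, y, z] :=
      ⟨v 0, v 1, v 2, by ext i; fin_cases i <;> rfl⟩
    rw [covD_apply_three]
    simp only [curvForm_apply]
    ext u
    have h : D.toLinearMap ⁅⁅x, y⁆, z⁆ u =
        D.toLinearMap ⁅x, ⁅y, z⁆⁆ u - D.toLinearMap ⁅y, ⁅x, z⁆⁆ u := by
      rw [lie_lie, map_sub, LinearMap.sub_apply]
    simp only [LinearMap.sub_apply, LinearMap.add_apply, endConn_apply, LConnection.curvatureEnd,
      LinearMap.coe_mk, AddHom.coe_mk, map_sub, h]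
    change _ = (0 : V)
    abel

end EndConnection

section Variation

variable {k A L V : Type*} [Field k] [CommRing A] [Algebra k A]
  [LieRing L] [LieAlgebra k L] [Module A L] [LieRingModule L A] [LieRinehartRing A L]
  [LieRinehartAlgebra k A L] [AddCommGroup V] [Module k V] [Module A V] [IsScalarTower k A V]

omit [LieAlgebra k L] [LieRinehartAlgebra k A L] in
theorem curvForm_apply_of_ne (D : LConnection k A L V) {n : ℕ} (hn : n ≠ 2) :
    curvForm D n = 0 := by
  rw [curvForm, DirectSum.of_eq_of_ne _ _ _ hn]

variable [CharZero k]

theorem covD_oneForm_apply_of_ne (D : LConnection k A L V) (η : L →ₗ[A] Module.End A V) {n : ℕ}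
    (hn : n ≠ 2) : covD (endConn D) (oneForm A η) n = 0 := by
  rw [oneForm, covD_of, DirectSum.of_eq_of_ne _ _ _ hn]

/-- The curvature along the line `∇ + s η` of connections. -/
theorem curvForm_addForm [IsAddTorsionFree (Module.End A V)] (D : LConnection k A L V)
    (η : L →ₗ[A] Module.End A V) (s : k) : curvForm (D.addForm (s • η)) =
      curvForm D + s • covD (endConn D) (oneForm A η) +
        s ^ 2 • cup (oneForm A η) (oneForm A η) := by
  refine forms_ext_of_degree (m := 2) (fun n hn => curvForm_apply_of_ne _ hn) (fun n hn => ?_)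
    (fun v => ?_)
  · rw [DirectSum.add_apply, DirectSum.add_apply, forms_smul_apply, forms_smul_apply,
      curvForm_apply_of_ne _ hn, covD_oneForm_apply_of_ne _ _ hn,
      oneForm_cup_oneForm_apply_of_ne _ _ hn]
    simp
  · obtain ⟨x, y, rfl⟩ : ∃ x y, v = ![x, y] := ⟨v 0, v 1, by ext i; fin_cases i <;> rfl⟩
    rw [DirectSum.add_apply, DirectSum.add_apply, forms_smul_apply, forms_smul_apply,
      AlternatingMap.add_apply, AlternatingMap.add_apply, AlternatingMap.smul_apply,
      AlternatingMap.smul_apply, curvForm_apply, curvForm_apply, covD_apply_two, oneForm_apply,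
      oneForm_apply, oneForm_apply, oneForm_cup_oneForm_apply]
    ext u
    have ha : ∀ X v, (D.addForm (s • η)).toLinearMap X v = D.toLinearMap X v + s • η X v :=
      fun _ _ => rfl
    have hη : ∀ X (c : k) v, η X (c • v) = c • η X v := fun X c v => (η X).map_smul_of_tower c v
    simp only [LinearMap.add_apply, LinearMap.smul_apply, LinearMap.sub_apply, endConn_apply,
      LConnection.curvatureEnd, LinearMap.coe_mk, AddHom.coe_mk, ha, map_add, map_smul,
      Module.End.mul_apply, hη]
    module

/-- The covariant derivative of `η` along the line `∇ + s η` of connections. -/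
theorem covD_addForm_oneForm [IsAddTorsionFree (Module.End A V)] (D : LConnection k A L V)
    (η : L →ₗ[A] Module.End A V) (s : k) : covD (endConn (D.addForm (s • η))) (oneForm A η) =
      covD (endConn D) (oneForm A η) + (2 * s) • cup (oneForm A η) (oneForm A η) := by
  refine forms_ext_of_degree (m := 2) (fun n hn => covD_oneForm_apply_of_ne _ _ hn) (fun n hn => ?_)
    (fun v => ?_)
  · rw [DirectSum.add_apply, forms_smul_apply, covD_oneForm_apply_of_ne _ _ hn,
      oneForm_cup_oneForm_apply_of_ne _ _ hn]
    simp
  · obtain ⟨x, y, rfl⟩ : ∃ x y, v = ![x, y] := ⟨v 0, v 1, by ext i; fin_cases i <;> rfl⟩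
    rw [DirectSum.add_apply, forms_smul_apply,
      AlternatingMap.add_apply, AlternatingMap.smul_apply, covD_apply_two, covD_apply_two,
      oneForm_apply, oneForm_apply, oneForm_apply, oneForm_cup_oneForm_apply]
    ext u
    have ha : ∀ X v, (D.addForm (s • η)).toLinearMap X v = D.toLinearMap X v + s • η X v :=
      fun _ _ => rfl
    have hη : ∀ X (c : k) v, η X (c • v) = c • η X v := fun X c v => (η X).map_smul_of_tower c v
    simp only [LinearMap.add_apply, LinearMap.smul_apply, LinearMap.sub_apply, endConn_apply,
      ha, map_add, Module.End.mul_apply, hη]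
    module

/-- The derivative of the curvature along the line `∇ + s η` is the covariant derivative of `η`. -/
theorem curvForm_mem_polyDerivPairs [IsAddTorsionFree (Module.End A V)] (D : LConnection k A L V)
    (η : L →ₗ[A] Module.End A V) :
    ((fun s : k => curvForm (D.addForm (s • η))),
      (fun s : k => covD (endConn (D.addForm (s • η))) (oneForm A η))) ∈
      polyDerivPairs k (Forms A L (Module.End A V)) := by
  convert add_mem (add_mem (const_mem_polyDerivPairs (k := k) (curvForm D))
    (monomial_mem_polyDerivPairs (k := k) 1 (covD (endConn D) (oneForm A η))))
    (monomial_mem_polyDerivPairs (k := k) 2 (cup (oneForm A η) (oneForm A η))) using 1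
  refine Prod.ext (funext fun s => ?_) (funext fun s => ?_)
  · simp [curvForm_addForm]
  · simp [covD_addForm_oneForm]

end Variation

/-! ### Closedness and the transgression formula -/

section PowerRule

variable {k A L : Type*} [Field k] [CommRing A] [Algebra k A] [AddCommGroup L] [Module A L]

section

variable {E : Type*} [Ring E] [Algebra A E] [Module k E] [IsScalarTower k A E]

theorem polyForm_add (f g : k[X]) (ω : Forms A L E) :
    polyForm (f + g) ω = polyForm f ω + polyForm g ω := by
  rw [polyForm, Polynomial.sum_add_index] <;> simp [polyForm, add_smul]

theorem polyForm_monomial (n : ℕ) (c : k) (ω : Forms A L E) :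
    polyForm (Polynomial.monomial n c) ω = c • cupPow ω n := by
  rw [polyForm, Polynomial.sum_monomial_index _ _ (by simp), algebraMap_smul]

theorem cupPow_add [IsAddTorsionFree E] (ω : Forms A L E) (m n : ℕ) :
    cup (cupPow ω m) (cupPow ω n) = cupPow ω (m + n) := by
  induction n with
  | zero => exact cup_cupPow_zero ω _
  | succ n ih => rw [← add_assoc, cupPow, cupPow, ← cup_assoc, ih]

/-- A polynomial family of forms is multiplied by polynomial families according to the product
rule. -/
theorem cup_mem_polyDerivPairs {a a' b b' : k → Forms A L E}
    (ha : (a, a') ∈ polyDerivPairs k (Forms A L E))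
    (hb : (b, b') ∈ polyDerivPairs k (Forms A L E)) :
    ((fun s => cup (a s) (b s)), (fun s => cup (a' s) (b s) + cup (a s) (b' s))) ∈
      polyDerivPairs k (Forms A L E) :=
  mul_mem_polyDerivPairs (LinearMap.restrictScalars₁₂ k k cup) ha hb

theorem exists_polyForm_mem_polyDerivPairs (f : k[X]) {ω ω' : k → Forms A L E}
    (h : (ω, ω') ∈ polyDerivPairs k (Forms A L E)) :
    ∃ Q, ((fun s => polyForm f (ω s)), Q) ∈ polyDerivPairs k (Forms A L E) := by
  induction f using Polynomial.induction_on' with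
  | add f g hf hg =>
    obtain ⟨P, hP⟩ := hf
    obtain ⟨Q, hQ⟩ := hg
    refine ⟨P + Q, ?_⟩
    simp only [polyForm_add]
    exact add_mem hP hQ
  | monomial n c =>
    simp only [polyForm_monomial]
    suffices H : ∃ Q, ((fun s => cupPow (ω s) n), Q) ∈ polyDerivPairs k (Forms A L E) by
      obtain ⟨Q, hQ⟩ := H
      exact ⟨c • Q, Submodule.smul_mem _ c hQ⟩
    induction n with
    | zero => exact ⟨_, const_mem_polyDerivPairs (cupPow (0 : Forms A L E) 0)⟩
    | succ n ih =>
      obtain ⟨Q, hQ⟩ := ih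
      exact ⟨_, cup_mem_polyDerivPairs hQ h⟩

end

variable {V : Type*} [AddCommGroup V] [Module k V] [Module A V] [IsScalarTower k A V]
  [Module.Finite A V] [Module.Projective A V] [IsAddTorsionFree (Module.End A V)]
  [IsAddTorsionFree A]

/-- The noncommutative power rule under the trace. The derivative `Q` of the `n`-th power is
described by the traces of its products with all powers, so that the induction on `n` goes
through. -/
theorem exists_cupPow_mem_polyDerivPairs {ω ω' : k → Forms A L (Module.End A V)}
    (h : (ω, ω') ∈ polyDerivPairs k (Forms A L (Module.End A V)))
    (hω : ∀ s, parity (ω s) = ω s) (n : ℕ) :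
    ∃ Q, ((fun s => cupPow (ω s) n), Q) ∈ polyDerivPairs k (Forms A L (Module.End A V)) ∧
      ∀ s m, traceForms (cup (Q s) (cupPow (ω s) m)) =
        n • traceForms (cup (ω' s) (cupPow (ω s) (n + m - 1))) := by
  induction n with
  | zero =>
    exact ⟨_, const_mem_polyDerivPairs (cupPow (0 : Forms A L (Module.End A V)) 0),
      fun s m => by simp⟩
  | succ n ih =>
    obtain ⟨Q, hQ, hQ'⟩ := ih
    refine ⟨_, cup_mem_polyDerivPairs hQ h, fun s m => ?_⟩
    have h1 : n + (m + 1) - 1 = n + m := by omega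
    have h2 : n + 1 + m - 1 = n + m := by omega
    rw [map_add, LinearMap.add_apply, map_add, cup_assoc, cup_cupPow, hQ', cup_assoc,
      traceForms_cup_comm (parity_cupPow (hω s) n), cup_assoc, cupPow_add, h1, h2, add_comm m,
      succ_nsmul]

/-- The derivative of `trace (f(ω))` is `trace (ω' f'(ω))`. -/
theorem traceForms_polyForm_mem_polyDerivPairs (f : k[X]) {ω ω' : k → Forms A L (Module.End A V)}
    (h : (ω, ω') ∈ polyDerivPairs k (Forms A L (Module.End A V)))
    (hω : ∀ s, parity (ω s) = ω s) :
    ((fun s => traceForms (polyForm f (ω s))),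
      (fun s => traceForms (cup (ω' s) (polyForm (Polynomial.derivative f) (ω s))))) ∈
      polyDerivPairs k (Forms A L A) := by
  induction f using Polynomial.induction_on' with
  | add f g hf hg =>
    simp only [polyForm_add, map_add]
    exact add_mem hf hg
  | monomial n c =>
    obtain ⟨Q, hQ, hQ'⟩ := exists_cupPow_mem_polyDerivPairs h hω n
    have := Submodule.smul_mem _ c (map_mem_polyDerivPairs (traceForms.restrictScalars k) hQ)
    convert this using 1
    refine Prod.ext (funext fun s => ?_) (funext fun s => ?_)
    · simp only [polyForm_monomial]
      exact LinearMap.map_smul_of_tower _ c _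
    · have hs := hQ' s 0
      rw [cup_cupPow_zero, add_zero] at hs
      change traceForms (cup (ω' s) (polyForm _ (ω s))) = c • traceForms (Q s)
      rw [hs, Polynomial.derivative_monomial, polyForm_monomial, LinearMap.map_smul_of_tower,
        LinearMap.map_smul_of_tower, mul_smul, Nat.cast_smul_eq_nsmul]

end PowerRule

section Transgression

variable {k A L V : Type*} [Field k] [CharZero k] [CommRing A] [Algebra k A]
  [LieRing L] [LieAlgebra k L] [Module A L] [LieRingModule L A] [LieRinehartRing A L]
  [LieRinehartAlgebra k A L] [AddCommGroup V] [Module k V] [Module A V] [IsScalarTower k A V]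
  [IsAddTorsionFree (Module.End A V)]

theorem covD_cupPow_curvForm (D : LConnection k A L V) (n : ℕ) :
    covD (endConn D) (cupPow (curvForm D) n) = 0 := by
  induction n with
  | zero =>
    rw [cupPow, covD_of]
    refine (congr_arg _ ?_).trans (map_zero _)
    ext1 v
    change koszul (endConn D) _ v = 0
    simp [koszul, koszulBracket, endConn_one]
  | succ n ih => rw [cupPow, covD_cup (endConn_mul D), ih, covD_curvForm]; simp

/-- By the Bianchi identity, polynomials in the curvature are parallel. -/
theorem covD_polyForm_curvForm (D : LConnection k A L V) (f : k[X]) :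
    covD (endConn D) (polyForm f (curvForm D)) = 0 := by
  induction f using Polynomial.induction_on' with
  | add f g hf hg => rw [polyForm_add, map_add, hf, hg, add_zero]
  | monomial n c => rw [polyForm_monomial, map_smul, covD_cupPow_curvForm, smul_zero]

variable [Module.Finite A V] [Module.Projective A V]

theorem dDR_traceForms_polyCurvature (D : LConnection k A L V) (f : k[X]) :
    dDR k A L (traceForms (D.polyCurvature f)) = 0 := by
  rw [dDR_traceForms D]
  exact (congr_arg _ (covD_polyForm_curvForm D f)).trans (map_zero _)

theorem isPolynomialFamily_transgression (D : LConnection k A L V) (η : L →ₗ[A] Module.End A V)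
    (f : k[X]) : IsPolynomialFamily (fun s : k =>
      traceForms (cup (oneForm A η) ((D.addForm (s • η)).polyCurvature f))) := by
  obtain ⟨Q, hQ⟩ := exists_polyForm_mem_polyDerivPairs f (curvForm_mem_polyDerivPairs D η)
  exact isPolynomialFamily_of_mem (map_mem_polyDerivPairs (traceForms.restrictScalars k)
    (cup_mem_polyDerivPairs (const_mem_polyDerivPairs (oneForm A η)) hQ))

/-- The transgression formula. -/
theorem traceForms_polyCurvature_sub [IsAddTorsionFree A] (D : LConnection k A L V)
    (η : L →ₗ[A] Module.End A V) (f : k[X]) :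
    traceForms ((D.addForm η).polyCurvature f) - traceForms (D.polyCurvature f) =
      dDR k A L (integral01 fun s : k => traceForms (cup (oneForm A η)
        ((D.addForm (s • η)).polyCurvature (Polynomial.derivative f)))) := by
  have h : integral01 (fun s : k => traceForms (cup
      (covD (endConn (D.addForm (s • η))) (oneForm A η))
        ((D.addForm (s • η)).polyCurvature (Polynomial.derivative f)))) =
      traceForms ((D.addForm ((1 : k) • η)).polyCurvature f) -
        traceForms ((D.addForm ((0 : k) • η)).polyCurvature f) :=
    integral01_of_mem (traceForms_polyForm_mem_polyDerivPairs f
      (curvForm_mem_polyDerivPairs D η) fun s => parity_curvForm _)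
  have h1 : D.addForm ((1 : k) • η) = D.addForm η := by rw [one_smul]
  have h0 : D.addForm ((0 : k) • η) = D := by
    rw [zero_smul]
    ext X v
    exact add_zero _
  have hd : ∀ D' : LConnection k A L V,
      dDR k A L (traceForms (cup (oneForm A η) (D'.polyCurvature (Polynomial.derivative f)))) =
        traceForms (cup (covD (endConn D') (oneForm A η))
          (D'.polyCurvature (Polynomial.derivative f))) := fun D' => by
    have h2 : covD (endConn D') (D'.polyCurvature (Polynomial.derivative f)) = 0 :=
      covD_polyForm_curvForm D' _
    rw [dDR_traceForms D', covD_cup (D := endConn D') (endConn_mul D'), h2, map_zero, add_zero]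
  rw [h1, h0] at h
  rw [← h, ← integral01_map _ (isPolynomialFamily_transgression D η _)]
  exact congr_arg integral01 (funext fun s => (hd _).symm)

end Transgression

end ChernWeil

end

theorem mainTheorem1 {k A L V : Type*} [Field k] [CharZero k] [CommRing A] [Algebra k A]
    [LieRing L] [LieAlgebra k L] [Module A L] [LieRingModule L A] [LieRinehartRing A L]
    [LieRinehartAlgebra k A L] [AddCommGroup V] [Module k V] [Module A V] [IsScalarTower k A V]
    [Module.Finite A V] [Module.Projective A V] (f : k[X]) :
    ∃ hclosed : ∀ D : LConnection k A L V, dDR k A L (traceForms (D.polyCurvature f)) = 0,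
      (∀ (D : LConnection k A L V) (η : L →ₗ[A] Module.End A V),
        IsPolynomialFamily (fun s : k =>
          traceForms (cup (oneForm A η)
            ((D.addForm (s • η)).polyCurvature (Polynomial.derivative f)))) ∧
        traceForms ((D.addForm η).polyCurvature f) - traceForms (D.polyCurvature f) =
          dDR k A L (integral01 fun s : k =>
            traceForms (cup (oneForm A η)
              ((D.addForm (s • η)).polyCurvature (Polynomial.derivative f))))) ∧
      ∀ D D' : LConnection k A L V,
        HdR.mk (traceForms (D.polyCurvature f)) (hclosed D) =
          HdR.mk (traceForms (D'.polyCurvature f)) (hclosed D') := by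
  have : IsAddTorsionFree A := .of_isTorsionFree k A
  have : IsAddTorsionFree (Module.End A V) := .of_isTorsionFree k _
  refine ⟨fun D => dDR_traceForms_polyCurvature D f, fun D η =>
    ⟨isPolynomialFamily_transgression D η _, traceForms_polyCurvature_sub D η f⟩, fun D D' => ?_⟩
  -- The difference of two connections is an `End V`-valued one-form.
  let η : L →ₗ[A] Module.End A V :=
    { toFun := fun X =>
        { toFun := fun v => D.toLinearMap X v - D'.toLinearMap X v
          map_add' := fun v w => by simp only [map_add]; abel
          map_smul' := fun a v => by
            simp only [D.leibniz, D'.leibniz, RingHom.id_apply, smul_sub]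
            abel }
      map_add' := fun X Y => by ext v; simp; abel
      map_smul' := fun a X => by ext v; simp [smul_sub] }
  have hη : D'.addForm η = D := by
    ext X v
    exact add_sub_cancel _ _
  have h := traceForms_polyCurvature_sub D' η f
  rw [hη] at h
  exact (EndCohomology.mk_eq_mk _ _ _ _ _).mpr ⟨_, h.symm⟩
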